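/- **Conventions.** A $k$-quasi-median of vertices $x_1,x_2,x_3$ of a connected graph $X$ is a triple of vertices $(y_1,y_2,y_3)$, pairwise at distance $k$, such that for all $i\ne j$ some geodesic from $x_i$ to $x_j$ passes through $y_i$ and then $y_j$, with $k$ as small as possible. A *quasi-median graph* is a connected simplicial graph $X$ in which every triple of vertices has a unique quasi-median, which does not contain $K_4$ minus an edge as an induced subgraph, and in which the convex hull of every isometrically embedded 6-cycle is a 3-cube. A *hyperplane* of $X$ is a class of edges under the equivalence relation generated by identifying two sides of a triangle and opposite sides of an induced square; its *carrier* is the subgraph induced on the endpoints of its edges. Two hyperplanes *cross* if they are dual to two edges forming a corner of an induced square, and *osculate* if their carriers intersect but they do not cross. The *crossing graph* $\Delta X$ (resp. the *contact graph*) has the hyperplanes as vertices, two distinct ones being adjacent when they cross (resp. cross or osculate). A *graph factor system* on a simplicial graph $G$ is a collection $\mathfrak F$ of nonempty induced subgraphs of $G$ (domains) such that $G\in\mathfrak F$; the link of each vertex is in $\mathfrak F$ if it is nonempty; $F_1\cap F_2\in\mathfrak F$ whenever $F_1,F_2\in\mathfrak F$ and $F_1\cap F_2\neq\emptyset$; and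 there is $n>0$ such that every chain $F_1\subsetneq\dots\subsetneq F_k$ in $\mathfrak F$ has $k<n$. If $\Delta X$ admits a graph factor system, let $\mathfrak F$ be the minimal one, consisting of $\Delta X$ and all nonempty intersections of finitely many links of vertices of $\Delta X$. The *factored contact graph* $\widehat{CX}$ is the contact graph of $X$ together with one projection vertex $b_F$ for each $F\in\mathfrak F\setminus\{\Delta X\}$, where $b_F$ is joined by an edge to exactly the hyperplanes that are vertices of $F$. For $J\in\mathfrak F$, the factored contact graph $CJ$ of $J$ is the subgraph of $\widehat{CX}$ induced on the hyperplanes in $J$ and the projection vertices $b_F$ with $F\in\mathfrak F$, $F\subsetneq J$ (so $C(\Delta X)=\widehat{CX}$). **Lemma 4.15.** The factored contact graphs are uniform quasi-trees. That is, there are absolute constants $L\ge 1$ and $A\ge 0$ such that, for every quasi-median graph $X$ whose crossing graph $\Delta X$ admits a graph factor system, the graph $\widehat{CX}$, and more generally $CJ$ for every domain $J\in\mathfrak F$, is connected and $(L,A)$-quasi-isometric to a tree $T$: there is a map $f$ from its vertices to the vertices of $T$ with $L^{-1}d(x,y)-A\le d_T(f(x),f(y))\le L\,d(x,y)+A$ for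 all $x,y$, and every vertex of $T$ is within distance $A$ of the image of $f$. -/

import Mathlib

/-! ### Quasi-median graphs -/

universe u

namespace QMGraph

variable {V : Type u}

/-- `y₁, y₂, y₃` satisfies the first two conditions of a `k`-quasi-median of `x₁, x₂, x₃`:
for `i ≠ j` some geodesic from `xᵢ` to `xⱼ` passes through `yᵢ` and then `yⱼ`, and the `yᵢ` are
pairwise at distance `k` (used only in connected graphs). -/
def IsQuasiMedianCandidate (X : SimpleGraph V) (k : ℕ) (x₁ x₂ x₃ y₁ y₂ y₃ : V) : Prop :=
  (X.dist x₁ x₂ = X.dist x₁ y₁ + X.dist y₁ y₂ + X.dist y₂ x₂ ∧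
    X.dist x₁ x₃ = X.dist x₁ y₁ + X.dist y₁ y₃ + X.dist y₃ x₃ ∧
    X.dist x₂ x₃ = X.dist x₂ y₂ + X.dist y₂ y₃ + X.dist y₃ x₃) ∧
  (X.dist y₁ y₂ = k ∧ X.dist y₁ y₃ = k ∧ X.dist y₂ y₃ = k)

/-- `y₁, y₂, y₃` is a quasi-median of `x₁, x₂, x₃`: a candidate whose size `k` is minimal. -/
def IsQuasiMedianOf (X : SimpleGraph V) (x₁ x₂ x₃ y₁ y₂ y₃ : V) : Prop :=
  ∃ k, IsQuasiMedianCandidate X k x₁ x₂ x₃ y₁ y₂ y₃ ∧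
    ∀ k' z₁ z₂ z₃, IsQuasiMedianCandidate X k' x₁ x₂ x₃ z₁ z₂ z₃ → k ≤ k'

/-- A set of vertices is convex if it contains every vertex of every geodesic between its
elements. -/
def IsConvex (X : SimpleGraph V) (S : Set V) : Prop :=
  ∀ x ∈ S, ∀ y ∈ S, ∀ z, X.dist x z + X.dist z y = X.dist x y → z ∈ S

/-- The convex hull of a set of vertices. -/
def convHull (X : SimpleGraph V) (S : Set V) : Set V :=
  ⋂₀ {T | S ⊆ T ∧ IsConvex X T}

/-- The 1-skeleton of the 3-cube: two vertices are adjacent when they differ in exactly one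
coordinate. -/
def cube3 : SimpleGraph (Fin 3 → Bool) where
  Adj x y := ∃! i, x i ≠ y i
  symm := ⟨fun _ _ ⟨i, hi, hu⟩ => ⟨i, hi.symm, fun j hj => hu j (Ne.symm hj)⟩⟩
  loopless := ⟨fun _ ⟨_, hi, _⟩ => hi rfl⟩

/-- Quasi-median graphs. -/
structure IsQuasiMedianGraph (X : SimpleGraph V) : Prop where
  /-- `X` is connected (geodesics between any two vertices exist). -/
  connected : X.Connected
  /-- Every triple of vertices has a unique quasi-median. -/
  existsUnique_quasiMedian : ∀ x₁ x₂ x₃ : V,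
    ∃! y : V × V × V, IsQuasiMedianOf X x₁ x₂ x₃ y.1 y.2.1 y.2.2
  /-- No induced subgraph is `K₄` minus an edge. -/
  no_K4_minus : ∀ a b c d : V, X.Adj a b → X.Adj a c → X.Adj a d → X.Adj b c → X.Adj b d →
    c ≠ d → X.Adj c d
  /-- The convex hull of every isometrically embedded 6-cycle is a 3-cube. -/
  hexagon_hull : ∀ f : Fin 6 → V,
    (∀ i j, X.dist (f i) (f j) = (SimpleGraph.cycleGraph 6).dist i j) →
    Nonempty (X.induce (convHull X (Set.range f)) ≃g cube3)

/-! ### Hyperplanes -/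

/-- `a, b, c, d` are the consecutive vertices of an induced square. -/
def IsInducedSquare (X : SimpleGraph V) (a b c d : V) : Prop :=
  X.Adj a b ∧ X.Adj b c ∧ X.Adj c d ∧ X.Adj d a ∧ a ≠ c ∧ b ≠ d ∧ ¬ X.Adj a c ∧ ¬ X.Adj b d

/-- Two edges are elementarily parallel if they are two sides of a triangle or two opposite sides
of an induced square. -/
def ElemParallel (X : SimpleGraph V) (e f : X.edgeSet) : Prop :=
  (∃ a b c, X.Adj a b ∧ X.Adj b c ∧ X.Adj a c ∧ (e : Sym2 V) = s(a, b) ∧ (f : Sym2 V) = s(a, c)) ∨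
  (∃ a b c d, IsInducedSquare X a b c d ∧ (e : Sym2 V) = s(a, b) ∧ (f : Sym2 V) = s(d, c))

/-- Parallelism of edges: the equivalence relation generated by `ElemParallel`. -/
def parallelSetoid (X : SimpleGraph V) : Setoid X.edgeSet :=
  Relation.EqvGen.setoid (ElemParallel X)

/-- Hyperplanes: parallelism classes of edges. -/
def Hyperplane (X : SimpleGraph V) : Type u := Quotient (parallelSetoid X)

/-- The hyperplane dual to an edge. -/
def dualHyperplane (X : SimpleGraph V) (e : X.edgeSet) : Hyperplane X :=
  Quotient.mk (parallelSetoid X) e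

/-- The (vertex set of the) carrier of `H`: the endpoints of the edges dual to `H`. -/
def carrier (X : SimpleGraph V) (H : Hyperplane X) : Set V :=
  {v | ∃ e : X.edgeSet, dualHyperplane X e = H ∧ v ∈ (e : Sym2 V)}

/-- `H` and `K` cross if they are dual to two edges that form a corner of an induced square. -/
def Crosses (X : SimpleGraph V) (H K : Hyperplane X) : Prop :=
  ∃ (a b c d : V) (e f : X.edgeSet), IsInducedSquare X a b c d ∧
    (e : Sym2 V) = s(a, b) ∧ (f : Sym2 V) = s(a, d) ∧
    dualHyperplane X e = H ∧ dualHyperplane X f = K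

/-- `H` and `K` osculate if their carriers intersect but they do not cross. -/
def Osculates (X : SimpleGraph V) (H K : Hyperplane X) : Prop :=
  (carrier X H ∩ carrier X K).Nonempty ∧ ¬ Crosses X H K

theorem IsInducedSquare.reflect {X : SimpleGraph V} {a b c d : V} (h : IsInducedSquare X a b c d) :
    IsInducedSquare X a d c b := by
  obtain ⟨h1, h2, h3, h4, h5, h6, h7, h8⟩ := h
  exact ⟨h4.symm, h3.symm, h2.symm, h1.symm, h5, h6.symm, h7, fun h => h8 h.symm⟩

theorem Crosses.symm {X : SimpleGraph V} {H K : Hyperplane X} (h : Crosses X H K) :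
    Crosses X K H := by
  obtain ⟨a, b, c, d, e, f, hs, he, hf, hH, hK⟩ := h
  exact ⟨a, d, c, b, f, e, hs.reflect, hf, he, hK, hH⟩

theorem Osculates.symm {X : SimpleGraph V} {H K : Hyperplane X} (h : Osculates X H K) :
    Osculates X K H :=
  ⟨by rw [Set.inter_comm]; exact h.1, fun hc => h.2 hc.symm⟩

/-- The crossing graph: distinct hyperplanes are adjacent when they cross. -/
def crossingGraph (X : SimpleGraph V) : SimpleGraph (Hyperplane X) where
  Adj H K := H ≠ K ∧ Crosses X H K
  symm := ⟨fun _ _ h => ⟨h.1.symm, h.2.symm⟩⟩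
  loopless := ⟨fun _ h => h.1 rfl⟩

/-- The contact graph: distinct hyperplanes are adjacent when they cross or osculate. -/
def contactGraph (X : SimpleGraph V) : SimpleGraph (Hyperplane X) where
  Adj H K := H ≠ K ∧ (Crosses X H K ∨ Osculates X H K)
  symm := ⟨fun _ _ h => ⟨h.1.symm, h.2.imp Crosses.symm Osculates.symm⟩⟩
  loopless := ⟨fun _ h => h.1 rfl⟩

/-! ### Factor systems and factored contact graphs -/

/-- A graph factor system on a simplicial graph `G`; its members, the domains, are nonempty induced
subgraphs, given by their vertex sets. The link of a vertex `v` is spanned by its neighbours. -/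
structure IsGraphFactorSystem {U : Type u} (G : SimpleGraph U) (𝔉 : Set (Set U)) : Prop where
  nonempty_of_mem : ∀ F ∈ 𝔉, F.Nonempty
  univ_mem : Set.univ ∈ 𝔉
  link_mem : ∀ v, (G.neighborSet v).Nonempty → G.neighborSet v ∈ 𝔉
  inter_mem : ∀ F₁ ∈ 𝔉, ∀ F₂ ∈ 𝔉, (F₁ ∩ F₂).Nonempty → F₁ ∩ F₂ ∈ 𝔉
  /-- Finite complexity: the lengths of strictly increasing chains of domains are bounded. -/
  complexity : ∃ n : ℕ, 0 < n ∧ ∀ (k : ℕ) (F : Fin k → Set U),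
    (∀ i, F i ∈ 𝔉) → StrictMono F → k < n

/-- The domains of the minimal factor system of a graph `G`: `G` itself and the nonempty
intersections of finitely many (at least one) links of vertices. -/
def minimalDomains {U : Type u} (G : SimpleGraph U) : Set (Set U) :=
  {F | F.Nonempty ∧
    (F = Set.univ ∨ ∃ s : Finset U, s.Nonempty ∧ F = ⋂ v ∈ s, G.neighborSet v)}

/-- The domains of a quasi-median graph: those of the minimal factor system of its crossing
graph. -/
def domains (X : SimpleGraph V) : Set (Set (Hyperplane X)) :=
  minimalDomains (crossingGraph X)

/-- The projection vertices `b_F`: one for each domain `F` other than the whole crossing graph. -/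
abbrev ProjVertex (X : SimpleGraph V) : Type u :=
  {F : Set (Hyperplane X) // F ∈ domains X ∧ F ≠ Set.univ}

/-- Adjacency in the factored contact graph: hyperplanes are adjacent as in the contact graph, a
hyperplane `H` is adjacent to a projection vertex `b_F` when `H ∈ F`, and projection vertices are
pairwise non-adjacent. -/
def FactoredAdj (X : SimpleGraph V) :
    Hyperplane X ⊕ ProjVertex X → Hyperplane X ⊕ ProjVertex X → Prop
  | Sum.inl H, Sum.inl K => (contactGraph X).Adj H K
  | Sum.inl H, Sum.inr F => H ∈ F.1
  | Sum.inr F, Sum.inl H => H ∈ F.1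
  | Sum.inr _, Sum.inr _ => False

/-- The factored contact graph of `X`. -/
def factoredContactGraph (X : SimpleGraph V) :
    SimpleGraph (Hyperplane X ⊕ ProjVertex X) where
  Adj := FactoredAdj X
  symm := ⟨by
    rintro (H | F) (K | F') h
    · exact SimpleGraph.Adj.symm h
    · exact h
    · exact h
    · exact h⟩
  loopless := ⟨by
    rintro (H | F) h
    · exact SimpleGraph.irrefl (contactGraph X) h
    · exact h⟩

/-- The vertices of the factored contact graph that belong to a domain `J`: the hyperplanes in `J`
and the projection vertices of the domains properly contained in `J`. -/
def domainVertices (X : SimpleGraph V) (J : Set (Hyperplane X)) :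
    Set (Hyperplane X ⊕ ProjVertex X) :=
  {z | Sum.elim (fun H => H ∈ J) (fun F => F.1 ⊂ J) z}

/-- The factored contact graph of a domain `J`: the subgraph of the factored contact graph of `X`
induced on `domainVertices X J`. -/
def factoredContactGraphOf (X : SimpleGraph V) (J : Set (Hyperplane X)) :
    SimpleGraph (domainVertices X J) :=
  (factoredContactGraph X).induce (domainVertices X J)

/-! ### Quasi-trees -/

/-- The connected graph `G`, with its path metric, is `(L, A)`-quasi-isometric to a tree. -/
def IsQuasiTreeWith {U : Type u} (L A : ℝ) (G : SimpleGraph U) : Prop :=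
  G.Connected ∧ ∃ (T : Type u) (Γ : SimpleGraph T), Γ.IsTree ∧ ∃ f : U → T,
    (∀ x y, L⁻¹ * (G.dist x y : ℝ) - A ≤ (Γ.dist (f x) (f y) : ℝ) ∧
      (Γ.dist (f x) (f y) : ℝ) ≤ L * (G.dist x y : ℝ) + A) ∧
    ∀ t, ∃ x, (Γ.dist t (f x) : ℝ) ≤ A

end QMGraph

/-! Bottlenecks detect quasi-trees. Suppose any two vertices of a graph are joined by a path that
stays within `δ` of every other path with the same ends. Cut each sphere around a base vertex into
clusters, namely vertices joined outside the open ball. Clusters form a tree, and each has diameter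
at most `6 * δ + 1`, so projecting to this tree distorts distances only additively
(`HasBottlenecks.isQuasiTreeWith`).

In a factored contact graph the bottlenecks are separating hyperplanes. Let `K` and `L` lie in a
domain `J`. A geodesic of `X` realizing the distance between their carriers crosses only hyperplanes
that separate `K` from `L` (`separates_of_dist`), and consecutive ones are equal or in contact. They
lie in `J`, because a hyperplane crossing both `K` and `L` crosses whatever separates them
(`crosses_of_separates`). This gives a path in the factored contact graph of `J`. Conversely, a walk
from `K` to `L` meets the unit ball around each separating `H`. Contacts cannot jump over `H`, since
a carrier not crossing `H` lies on one side of it; nor can a projection vertex whose domain omits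
`H`, since domains contain all separators. Ends that are projection vertices cost one more step, so
`δ = 2` works for every `X`.

The hyperplane geometry rests on three consequences of the definition: the triangle condition, the
quadrangle condition and the absence of induced `K_{2,3}`. They show that dual edges cut `X` into
well-defined sides, and that crossing hyperplanes span a square wherever they share a vertex
(`exists_square_of_crosses`). -/

namespace QMGraph

variable {V : Type u} {X : SimpleGraph V}

/-! ### The 3-cube and the 6-cycle. -/

/-- Flipping one coordinate of a vertex of the cube. -/
def cubeFlip (z : Fin 3 → Bool) (i : Fin 3) : Fin 3 → Bool := fun j => if j = i then !z j else z j

theorem cube3_adj_iff (x y : Fin 3 → Bool) : cube3.Adj x y ↔ ∃ i, y = cubeFlip x i := by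
  constructor
  · rintro ⟨i, hi, hu⟩
    refine ⟨i, funext fun j => ?_⟩
    by_cases h : j = i
    · subst h
      simp only [cubeFlip, if_true]
      revert hi
      cases x j <;> cases y j <;> simp
    · simp only [cubeFlip, if_neg h]
      by_contra hne
      exact h (hu j (Ne.symm hne))
  · rintro ⟨i, rfl⟩
    refine ⟨i, by simp [cubeFlip], fun j hj => ?_⟩
    by_contra h
    exact hj (by simp [cubeFlip, h])

/-- Three flips change the parity, so the end vertex is a neighbour of `z` or its antipode; the
antipode is adjacent to every vertex at distance two from `z`. -/
theorem cubeFlip_third : ∀ (z : Fin 3 → Bool) (i j m n : Fin 3), i ≠ j →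
    (∃ k, cubeFlip (cubeFlip (cubeFlip z i) m) n = cubeFlip z k) ∨
    (∃ k, cubeFlip (cubeFlip (cubeFlip z i) m) n = cubeFlip (cubeFlip (cubeFlip z i) j) k) := by
  decide

theorem cubeFlip_comm (z : Fin 3 → Bool) (i j : Fin 3) :
    cubeFlip (cubeFlip z i) j = cubeFlip (cubeFlip z j) i := by
  funext k
  simp only [cubeFlip]
  split_ifs <;> rfl

/-- In the cube, two neighbours of `z` and an antipode of `z` have a common neighbour. -/
theorem cube3_exists_common {z v w p y : Fin 3 → Bool} (hzv : cube3.Adj z v)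
    (hzw : cube3.Adj z w) (hvw : v ≠ w) (hvp : cube3.Adj v p) (hpy : cube3.Adj p y)
    (hzy : ¬ cube3.Adj z y) : ∃ x, cube3.Adj v x ∧ cube3.Adj w x ∧ cube3.Adj x y := by
  obtain ⟨i, rfl⟩ := (cube3_adj_iff _ _).1 hzv
  obtain ⟨j, rfl⟩ := (cube3_adj_iff _ _).1 hzw
  obtain ⟨m, rfl⟩ := (cube3_adj_iff _ _).1 hvp
  obtain ⟨n, rfl⟩ := (cube3_adj_iff _ _).1 hpy
  refine ⟨cubeFlip (cubeFlip z i) j, (cube3_adj_iff _ _).2 ⟨j, rfl⟩,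
    (cube3_adj_iff _ _).2 ⟨i, cubeFlip_comm z i j⟩, (cube3_adj_iff _ _).2 ?_⟩
  rcases cubeFlip_third z i j m n (fun h => hvw (h ▸ rfl)) with h | h
  · exact absurd ((cube3_adj_iff _ _).2 h) hzy
  · exact h

theorem isQuasiMedianOf_zero {x₁ x₂ x₃ y : V} (h₁₂ : X.dist x₁ x₂ = X.dist x₁ y + X.dist y x₂)
    (h₁₃ : X.dist x₁ x₃ = X.dist x₁ y + X.dist y x₃)
    (h₂₃ : X.dist x₂ x₃ = X.dist x₂ y + X.dist y x₃) : IsQuasiMedianOf X x₁ x₂ x₃ y y y :=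
  ⟨0, ⟨⟨by simpa using h₁₂, by simpa using h₁₃, by simpa using h₂₃⟩, by simp⟩, by simp⟩

/-- An upper bound is enough to recognize an isometric hexagon: distances in `X` are at most those
of the cycle, and will be checked to be at least this minimum. -/
theorem cycleGraph_six_dist_le (i j : Fin 6) :
    (SimpleGraph.cycleGraph 6).dist i j ≤ min (j - i : Fin 6).val (i - j : Fin 6).val := by
  have key : ∀ (n : ℕ) (i j : Fin 6), (j - i : Fin 6).val = n →
      (SimpleGraph.cycleGraph 6).dist i j ≤ n := by
    intro n
    induction n with
    | zero =>
      intro i j h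
      rw [(by decide : ∀ i j : Fin 6, (j - i : Fin 6).val = 0 → j = i) i j h,
        SimpleGraph.dist_self]
    | succ n ih =>
      intro i j h
      have hadj : (SimpleGraph.cycleGraph 6).Adj (j - 1) j := by
        rw [SimpleGraph.cycleGraph_adj]
        exact Or.inr ((by decide : ∀ j : Fin 6, j - (j - 1) = 1) j)
      have hconn : (SimpleGraph.cycleGraph 6).Connected := SimpleGraph.cycleGraph_connected
      have h1 := hconn.dist_triangle (u := i) (v := j - 1) (w := j)
      rw [SimpleGraph.dist_eq_one_iff_adj.2 hadj] at h1
      have h2 := (by decide : ∀ i j : Fin 6, (j - i : Fin 6).val ≠ 0 →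
        (j - 1 - i : Fin 6).val + 1 = (j - i : Fin 6).val) i j (by omega)
      have h3 := ih i (j - 1) (by omega)
      omega
  refine le_min (key _ i j rfl) ?_
  rw [SimpleGraph.dist_comm]
  exact key _ j i rfl

/-! ### Triangle and quadrangle conditions. -/

namespace IsQuasiMedianGraph

theorem dist_le_succ_of_adj (hX : IsQuasiMedianGraph X) (u : V) {a b : V} (h : X.Adj a b) :
    X.dist u a ≤ X.dist u b + 1 := by
  have := hX.connected.dist_triangle (u := u) (v := b) (w := a)
  rwa [SimpleGraph.dist_eq_one_iff_adj.2 h.symm] at this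

/-- The triangle condition. -/
theorem exists_triangle (hX : IsQuasiMedianGraph X) {u v w : V} (hvw : X.Adj v w)
    (h : X.dist u v = X.dist u w) :
    ∃ x, X.Adj x v ∧ X.Adj x w ∧ X.dist u x + 1 = X.dist u v := by
  obtain ⟨⟨y₁, y₂, y₃⟩, ⟨k, ⟨⟨h12, h13, h23⟩, k12, k13, k23⟩, -⟩, -⟩ :=
    hX.existsUnique_quasiMedian u v w
  simp only at h12 h13 h23 k12 k13 k23
  rw [SimpleGraph.dist_eq_one_iff_adj.2 hvw] at h23
  have c2 : X.dist y₂ v = X.dist v y₂ := SimpleGraph.dist_comm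
  -- Since `u` is equidistant from `v` and `w`, the end segments at `v` and `w` have equal length,
  -- so `1 - k` is even.
  have hk : k = 1 := by omega
  subst hk
  have e2 : X.dist v y₂ = 0 := by omega
  have e3 : X.dist y₃ w = 0 := by omega
  rw [hX.connected.dist_eq_zero_iff] at e2 e3
  subst e2 e3
  exact ⟨y₁, SimpleGraph.dist_eq_one_iff_adj.1 k12, SimpleGraph.dist_eq_one_iff_adj.1 k13,
    by simp at h12; omega⟩

theorem dist_eq_two (hX : IsQuasiMedianGraph X) {z v w : V} (hv : X.Adj z v) (hw : X.Adj z w)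
    (hne : v ≠ w) (hvw : ¬ X.Adj v w) : X.dist v w = 2 := by
  have h1 := hX.dist_le_succ_of_adj v hw.symm
  rw [SimpleGraph.dist_comm (u := v) (v := z), SimpleGraph.dist_eq_one_iff_adj.2 hv] at h1
  have h0 : X.dist v w ≠ 0 := fun h => hne (hX.connected.dist_eq_zero_iff.1 h)
  have h2 : X.dist v w ≠ 1 := fun h => hvw (SimpleGraph.dist_eq_one_iff_adj.1 h)
  omega

theorem exists_adj_adj_of_dist_eq_two (hX : IsQuasiMedianGraph X) {v w : V} (h : X.dist v w = 2) :
    ∃ p, X.Adj v p ∧ X.Adj p w := by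
  obtain ⟨W, hW⟩ := hX.connected.exists_walk_length_eq_dist v w
  rw [h] at hW
  match W, hW with
  | .cons h1 (.cons h2 .nil), _ => exact ⟨_, h1, h2⟩

/-- The completion of an isometric hexagon to a cube. -/
theorem exists_common_of_hexagon (hX : IsQuasiMedianGraph X) {z v p y q w : V}
    (hzv : X.Adj z v) (hvp : X.Adj v p) (hpy : X.Adj p y) (hyq : X.Adj y q) (hqw : X.Adj q w)
    (hwz : X.Adj w z) (hzy : X.dist z y = 3) (hvq : X.dist v q = 3) (hpw : X.dist p w = 3) :
    ∃ x, X.Adj x v ∧ X.Adj x w ∧ X.Adj x y := by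
  have two : ∀ {a b c d : V}, X.Adj a b → X.Adj b c → X.Adj c d → X.dist a d = 3 →
      X.dist a c = 2 := by
    intro a b c d h1 h2 h3 h
    have e1 := hX.dist_le_succ_of_adj a h3.symm
    have e2 := hX.dist_le_succ_of_adj a h2.symm
    rw [SimpleGraph.dist_eq_one_iff_adj.2 h1] at e2
    omega
  have two' : ∀ {a b c d : V}, X.Adj a b → X.Adj b c → X.Adj c d → X.dist d a = 3 →
      X.dist a c = 2 := by
    intro a b c d h1 h2 h3 h
    exact two h1 h2 h3 (by rwa [SimpleGraph.dist_comm])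
  have d1 : ∀ {a b : V}, X.Adj a b → X.dist a b = 1 := SimpleGraph.dist_eq_one_iff_adj.2
  -- Opposite vertices at distance three force vertices two steps apart to be at distance two, so
  -- the hexagon is isometric.
  have hzp := two hzv hvp hpy hzy
  have hvy := two hvp hpy hyq hvq
  have hpq := two hpy hyq hqw hpw
  have hyw := two' hyq hqw hwz hzy
  have hqz := two' hqw hwz hzv hvq
  have hwv := two' hwz hzv hvp hpw
  set f : Fin 6 → V := ![z, v, p, y, q, w] with hf
  have hadj : ∀ i, X.Adj (f i) (f (i + 1)) := by
    intro i
    fin_cases i <;> simp [hf] <;> assumption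
  let φ : SimpleGraph.cycleGraph 6 →g X := ⟨f, by
    intro i j h
    rw [SimpleGraph.cycleGraph_adj] at h
    rcases h with h | h
    · have := (by decide : ∀ i j : Fin 6, i - j = 1 → i = j + 1) i j h
      rw [this]
      exact (hadj j).symm
    · have := (by decide : ∀ i j : Fin 6, i - j = 1 → i = j + 1) j i h
      rw [this]
      exact hadj i⟩
  have hle : ∀ i j, X.dist (f i) (f j) ≤ (SimpleGraph.cycleGraph 6).dist i j := by
    intro i j
    obtain ⟨W, hW⟩ := (SimpleGraph.cycleGraph_connected (n := 5)).exists_walk_length_eq_dist i j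
    rw [← hW, ← SimpleGraph.Walk.length_map φ W]
    exact SimpleGraph.dist_le _
  have hge : ∀ i j : Fin 6, min (j - i : Fin 6).val (i - j : Fin 6).val ≤
      X.dist (f i) (f j) := by
    have sym : ∀ a b : V, X.dist a b = X.dist b a := fun a b => SimpleGraph.dist_comm
    have key : ∀ i j : Fin 6, i ≤ j → min (j - i : Fin 6).val (i - j : Fin 6).val ≤
        X.dist (f i) (f j) := by
      intro i j hij
      have e1 := d1 hwz
      rw [sym] at e1 hqz hwv
      fin_cases i <;> fin_cases j <;> first
        | exact absurd hij (by decide)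
        | exact Nat.zero_le _
        | exact (d1 hzv).ge
        | exact (d1 hvp).ge
        | exact (d1 hpy).ge
        | exact (d1 hyq).ge
        | exact (d1 hqw).ge
        | exact e1.ge
        | exact hzp.ge
        | exact hvy.ge
        | exact hpq.ge
        | exact hyw.ge
        | exact hqz.ge
        | exact hwv.ge
        | exact hzy.ge
        | exact hvq.ge
        | exact hpw.ge
    intro i j
    rcases le_total i j with h | h
    · exact key i j h
    · rw [min_comm, SimpleGraph.dist_comm]; exact key j i h
  obtain ⟨e⟩ := hX.hexagon_hull f fun i j =>
    le_antisymm (hle i j) ((cycleGraph_six_dist_le i j).trans (hge i j))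
  have hmem : ∀ i, f i ∈ convHull X (Set.range f) := fun i T hT => hT.1 ⟨i, rfl⟩
  let g : Fin 6 → convHull X (Set.range f) := fun i => ⟨f i, hmem i⟩
  have hg : ∀ i j, cube3.Adj (e (g i)) (e (g j)) ↔ X.Adj (f i) (f j) := by
    intro i j
    rw [e.map_adj_iff]; rfl
  have hzy' : ¬ X.Adj z y := fun h => by rw [d1 h] at hzy; omega
  have hvw' : v ≠ w := fun h => by rw [h, SimpleGraph.dist_self] at hwv; omega
  obtain ⟨x, hx1, hx2, hx3⟩ := cube3_exists_common (z := e (g 0)) (v := e (g 1)) (w := e (g 5))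
    (p := e (g 2)) (y := e (g 3)) ((hg 0 1).2 hzv) ((hg 0 5).2 hwz.symm)
    (fun h => hvw' (congrArg Subtype.val (e.injective h))) ((hg 1 2).2 hvp) ((hg 2 3).2 hpy)
    (fun h => hzy' ((hg 0 3).1 h))
  obtain ⟨x, rfl⟩ := e.surjective x
  rw [e.map_adj_iff] at hx1 hx2 hx3
  exact ⟨x.1, hx1.symm, hx2.symm, hx3⟩

/-- The quadrangle condition. -/
theorem exists_quadrangle (hX : IsQuasiMedianGraph X) {u z v w : V} (hzv : X.Adj z v)
    (hzw : X.Adj z w) (hne : v ≠ w) (hvw : ¬ X.Adj v w) (hv : X.dist u v + 1 = X.dist u z)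
    (hw : X.dist u w + 1 = X.dist u z) :
    ∃ x, X.Adj x v ∧ X.Adj x w ∧ X.dist u x + 1 = X.dist u v := by
  by_contra hcon
  have nocommon : ∀ x, X.Adj x v → X.Adj x w → X.dist u x < X.dist u v → False := by
    intro x h1 h2 h3
    have := hX.dist_le_succ_of_adj u h1.symm
    exact hcon ⟨x, h1, h2, by omega⟩
  have h2 := hX.dist_eq_two hzv hzw hne hvw
  obtain ⟨⟨y₁, y₂, y₃⟩, ⟨k, ⟨⟨h12, h13, h23⟩, k12, k13, k23⟩, -⟩, -⟩ :=
    hX.existsUnique_quasiMedian u v w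
  simp only at h12 h13 h23 k12 k13 k23
  have c2 : X.dist y₂ v = X.dist v y₂ := SimpleGraph.dist_comm
  -- The end segments again have equal length, so `k` is 0 or 2. For 0 the median itself is the
  -- vertex sought. For 2 the hexagon `z v p y₁ q y₃` turns out to be isometric, and its cube
  -- supplies that vertex.
  by_cases hk0 : k = 0
  · subst hk0
    rw [hX.connected.dist_eq_zero_iff] at k12 k13
    subst k12 k13
    simp only [SimpleGraph.dist_self] at h12 h13 h23
    exact nocommon y₁ (SimpleGraph.dist_eq_one_iff_adj.1 (by omega))
      (SimpleGraph.dist_eq_one_iff_adj.1 (by omega)) (by omega)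
  have hk2 : k = 2 := by omega
  subst hk2
  have e2 : X.dist v y₂ = 0 := by omega
  have e3 : X.dist y₃ w = 0 := by omega
  rw [hX.connected.dist_eq_zero_iff] at e2 e3
  subst e2 e3
  simp only [SimpleGraph.dist_self, add_zero] at h12 h13
  obtain ⟨p, hyp, hpv⟩ := hX.exists_adj_adj_of_dist_eq_two k12
  obtain ⟨q, hyq, hqw⟩ := hX.exists_adj_adj_of_dist_eq_two k13
  have up := hX.dist_le_succ_of_adj u hyp.symm
  have uq := hX.dist_le_succ_of_adj u hyq.symm
  have hpw : ¬ X.Adj p y₃ := fun h => nocommon p hpv h (by omega)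
  have hqv : ¬ X.Adj q v := fun h => nocommon q h hqw (by omega)
  have up' := hX.dist_le_succ_of_adj u hpv.symm
  have uq' := hX.dist_le_succ_of_adj u hqw.symm
  -- a vertex at distance `k + 1` from `u` is not adjacent to one at distance `k - 1`
  have far : ∀ {a b : V}, X.dist u a + 2 ≤ X.dist u b → ¬ X.Adj a b := fun h hab => by
    have := hX.dist_le_succ_of_adj u hab.symm
    omega
  have hzp : X.dist z p = 2 := hX.dist_eq_two hzv.symm hpv.symm
    (fun h => by rw [h] at hv; omega) (fun h => far (by omega) h.symm)
  have hzq : X.dist z q = 2 := hX.dist_eq_two hzw.symm hqw.symm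
    (fun h => by rw [h] at hv; omega) (fun h => far (by omega) h.symm)
  have hzy : X.dist z y₁ = 3 := by
    have t1 := hX.dist_le_succ_of_adj z hyp
    have t2 := hX.connected.dist_triangle (u := u) (v := y₁) (w := z)
    rw [SimpleGraph.dist_comm (u := y₁)] at t2
    omega
  have hpq : p ≠ q := fun h => hpw (h ▸ hqw)
  have hpq' : ¬ X.Adj p q := by
    intro h
    obtain ⟨s, hsp, hsq, hs⟩ := hX.exists_triangle (u := z) h (by omega)
    have hsz : X.Adj z s := SimpleGraph.dist_eq_one_iff_adj.1 (by omega)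
    have hsy : s ≠ y₁ := fun h => by rw [h] at hs; omega
    have := hX.no_K4_minus p q s y₁ h hsp.symm hyp.symm hsq.symm hyq.symm hsy
    have := hX.dist_le_succ_of_adj z this.symm
    omega
  -- the two remaining diagonals are symmetric to each other
  have diag : ∀ {a b p q : V}, X.Adj z a → X.Adj z b → ¬ X.Adj a b → X.Adj p a → X.Adj q b →
      ¬ X.Adj q a → q ≠ a → X.dist u a + 1 = X.dist u z → X.dist u b + 1 = X.dist u z →
      X.dist z q = 2 → X.dist u q + 2 = X.dist u z → X.dist a q ≠ 2 := by
    intro a b p q hza hzb hab hpa hqb hqa hqa' ha hb hzq huq h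
    rw [SimpleGraph.dist_comm] at h hzq
    -- This `r` lies on the level of `a` as seen from `u`. A vertex `t` below the edge `ra` then
    -- forms with `z` two triangles on `ra`, forcing an edge between levels two apart.
    obtain ⟨r, hra, hrz, hr⟩ := hX.exists_triangle (u := q) hza.symm (by omega)
    have hrq : X.Adj q r := SimpleGraph.dist_eq_one_iff_adj.1 (by omega)
    have t1 := hX.dist_le_succ_of_adj u hrq.symm
    have t2 := hX.dist_le_succ_of_adj u hrz.symm
    obtain ⟨t, htr, hta, ht⟩ := hX.exists_triangle (u := u) hra (by omega)
    have htz : t ≠ z := fun h => by rw [h] at ht; omega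
    exact far (by omega) (hX.no_K4_minus r a t z hra htr.symm hrz hta.symm hza.symm htz)
  have three : ∀ {a q : V}, q ≠ a → ¬ X.Adj q a → X.dist a q ≠ 2 → X.dist z q = 2 → X.Adj z a →
      X.dist a q = 3 := by
    intro a q h1 h2 h3 h4 h5
    have t1 := hX.dist_le_succ_of_adj q h5.symm
    rw [SimpleGraph.dist_comm, SimpleGraph.dist_comm (v := z)] at t1
    have t0 : X.dist a q ≠ 0 := fun h => h1 (hX.connected.dist_eq_zero_iff.1 h).symm
    have t2 : X.dist a q ≠ 1 := fun h => h2 (SimpleGraph.dist_eq_one_iff_adj.1 h).symm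
    omega
  have hqv' : q ≠ v := fun h => hvw (h ▸ hqw)
  have hpw' : p ≠ y₃ := fun h => hvw (h ▸ hpv.symm)
  have hvq := three hqv' hqv (diag hzv hzw hvw hpv hqw hqv hqv' hv hw hzq (by omega)) hzq hzv
  have hwp := three hpw' hpw (diag hzw hzv (fun h => hvw h.symm) hqw hpv hpw hpw' hw hv hzp
    (by omega)) hzp hzw
  rw [SimpleGraph.dist_comm] at hwp
  obtain ⟨x, hxv, hxw, hxy⟩ := hX.exists_common_of_hexagon hzv hpv.symm hyp.symm hyq hqw
    hzw.symm hzy hvq hwp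
  have := hX.dist_le_succ_of_adj u hxy
  exact nocommon x hxv hxw (by omega)

/-- There is no induced `K_{2,3}`. -/
theorem eq_of_common_neighbors (hX : IsQuasiMedianGraph X) {a b x y z : V} (hax : X.Adj a x)
    (hay : X.Adj a y) (haz : X.Adj a z) (hbx : X.Adj b x) (hby : X.Adj b y) (hbz : X.Adj b z)
    (hxy : x ≠ y) (hxz : x ≠ z) (hyz : y ≠ z) (nxy : ¬ X.Adj x y) (nxz : ¬ X.Adj x z)
    (nyz : ¬ X.Adj y z) : a = b := by
  have med : ∀ c, X.Adj c x → X.Adj c y → X.Adj c z → IsQuasiMedianOf X x y z c c c := by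
    intro c h1 h2 h3
    apply isQuasiMedianOf_zero
    · rw [hX.dist_eq_two h1 h2 hxy nxy, SimpleGraph.dist_eq_one_iff_adj.2 h1.symm,
        SimpleGraph.dist_eq_one_iff_adj.2 h2]
    · rw [hX.dist_eq_two h1 h3 hxz nxz, SimpleGraph.dist_eq_one_iff_adj.2 h1.symm,
        SimpleGraph.dist_eq_one_iff_adj.2 h3]
    · rw [hX.dist_eq_two h2 h3 hyz nyz, SimpleGraph.dist_eq_one_iff_adj.2 h2.symm,
        SimpleGraph.dist_eq_one_iff_adj.2 h3]
  have := (hX.existsUnique_quasiMedian x y z).unique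
    (y₁ := (a, a, a)) (y₂ := (b, b, b)) (med a hax hay haz) (med b hbx hby hbz)
  exact congrArg Prod.fst this

end IsQuasiMedianGraph

/-! ### Dual edges and carriers. -/

/-- The vertices `a` and `b` span an edge dual to the hyperplane `H`. -/
def IsDual (X : SimpleGraph V) (H : Hyperplane X) (a b : V) : Prop :=
  ∃ h : X.Adj a b, dualHyperplane X ⟨s(a, b), h⟩ = H

namespace IsDual

variable {H K : Hyperplane X} {a b c d : V}

theorem adj (h : IsDual X H a b) : X.Adj a b := h.1

theorem of_edge {e : X.edgeSet} (he : (e : Sym2 V) = s(a, b)) (h : dualHyperplane X e = H) :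
    IsDual X H a b := by
  obtain ⟨e, he'⟩ := e
  subst he
  exact ⟨he', h⟩

theorem symm (h : IsDual X H a b) : IsDual X H b a := by
  obtain ⟨h1, h2⟩ := h
  exact of_edge (e := ⟨s(a, b), h1⟩) Sym2.eq_swap h2

theorem triangle (h : IsDual X H a b) (hac : X.Adj a c) (hbc : X.Adj b c) : IsDual X H a c := by
  obtain ⟨h1, rfl⟩ := h
  refine ⟨hac, Quotient.sound ?_⟩
  exact .symm _ _ (.rel _ _ (Or.inl ⟨a, b, c, h1, hbc, hac, rfl, rfl⟩))

theorem square (h : IsDual X H a b) (hs : IsInducedSquare X a b c d) : IsDual X H d c := by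
  obtain ⟨h1, rfl⟩ := h
  refine ⟨hs.2.2.1.symm, Quotient.sound ?_⟩
  exact .symm _ _ (.rel _ _ (Or.inr ⟨a, b, c, d, hs, rfl, rfl⟩))

theorem eq (h : IsDual X H a b) (h' : IsDual X K a b) : H = K := by
  obtain ⟨_, rfl⟩ := h
  exact h'.2

end IsDual

theorem mem_carrier_iff {H : Hyperplane X} {v : V} : v ∈ carrier X H ↔ ∃ w, IsDual X H v w := by
  constructor
  · rintro ⟨e, he, hv⟩
    obtain ⟨w, hw⟩ := hv
    exact ⟨w, IsDual.of_edge hw he⟩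
  · rintro ⟨w, h, rfl⟩
    exact ⟨_, rfl, by simp⟩

theorem carrier_nonempty (H : Hyperplane X) : (carrier X H).Nonempty := by
  obtain ⟨⟨e, he⟩, rfl⟩ := Quotient.exists_rep H
  induction e with | _ a b => exact ⟨a, ⟨s(a, b), he⟩, rfl, by simp⟩

theorem crosses_iff {H K : Hyperplane X} : Crosses X H K ↔
    ∃ a b c d, IsInducedSquare X a b c d ∧ IsDual X H a b ∧ IsDual X K a d := by
  constructor
  · rintro ⟨a, b, c, d, e, f, hs, he, hf, hH, hK⟩
    exact ⟨a, b, c, d, hs, .of_edge he hH, .of_edge hf hK⟩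
  · rintro ⟨a, b, c, d, hs, ⟨h1, hH⟩, ⟨h2, hK⟩⟩
    exact ⟨a, b, c, d, _, _, hs, rfl, rfl, hH, hK⟩

theorem Crosses.carrier_inter {H K : Hyperplane X} (h : Crosses X H K) :
    (carrier X H ∩ carrier X K).Nonempty := by
  obtain ⟨a, b, c, d, -, hH, hK⟩ := crosses_iff.1 h
  exact ⟨a, mem_carrier_iff.2 ⟨b, hH⟩, mem_carrier_iff.2 ⟨d, hK⟩⟩

/-! ### Sides of hyperplanes. -/

/-- `u` and `v` lie on the same side of every edge dual to `H`; that is, in the same sector. -/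
def SameSide (X : SimpleGraph V) (H : Hyperplane X) (u v : V) : Prop :=
  ∀ x y, IsDual X H x y → (X.dist u x < X.dist u y ↔ X.dist v x < X.dist v y)

namespace SameSide

variable {H : Hyperplane X} {u v w : V}

theorem refl (u : V) : SameSide X H u u := fun _ _ _ => Iff.rfl

theorem symm (h : SameSide X H u v) : SameSide X H v u := fun x y hxy => (h x y hxy).symm

theorem trans (h : SameSide X H u v) (h' : SameSide X H v w) : SameSide X H u w :=
  fun x y hxy => (h x y hxy).trans (h' x y hxy)

end SameSide

theorem SameSide.not_of_dist {H : Hyperplane X} {a b u v : V} (h : IsDual X H a b)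
    (hu : X.dist u a < X.dist u b) (hv : X.dist v b < X.dist v a) : ¬ SameSide X H u v :=
  fun hs => lt_asymm hv ((hs a b h).1 hu)

/-- `H` separates `K` from `L`: it neither equals nor crosses any of them, and their carriers lie
on different sides of it. -/
def Separates (X : SimpleGraph V) (H K L : Hyperplane X) : Prop :=
  (H ≠ K ∧ ¬ Crosses X H K) ∧ (H ≠ L ∧ ¬ Crosses X H L) ∧
    ∀ u ∈ carrier X K, ∀ v ∈ carrier X L, ¬ SameSide X H u v

/-- The vertices of the clique spanned by the edge `ab`, when there is no induced `K₄` minus an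
edge. -/
def edgeClique (X : SimpleGraph V) (a b : V) : Set V :=
  {z | (z = a ∨ X.Adj z a) ∧ (z = b ∨ X.Adj z b)}

/-- `g` is the vertex of the clique of `ab` that is closest to `u`. -/
def IsGate (X : SimpleGraph V) (a b u g : V) : Prop :=
  g ∈ edgeClique X a b ∧ ∀ z ∈ edgeClique X a b, z ≠ g → X.dist u g < X.dist u z

theorem IsGate.eq {a b u g h : V} (hg : IsGate X a b u g) (hh : IsGate X a b u h) : g = h := by
  by_contra hne
  exact lt_asymm (hg.2 h hh.1 (Ne.symm hne)) (hh.2 g hg.1 hne)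

theorem left_mem_edgeClique {a b : V} (h : X.Adj a b) : a ∈ edgeClique X a b :=
  ⟨Or.inl rfl, Or.inr h⟩

theorem right_mem_edgeClique {a b : V} (h : X.Adj a b) : b ∈ edgeClique X a b :=
  ⟨Or.inr h.symm, Or.inl rfl⟩

theorem IsInducedSquare.flip {a b c d : V} (h : IsInducedSquare X a b c d) :
    IsInducedSquare X d c b a := by
  obtain ⟨h1, h2, h3, h4, h5, h6, h7, h8⟩ := h
  exact ⟨h3.symm, h2.symm, h1.symm, h4.symm, h6.symm, h5.symm, fun h => h8 h.symm,
    fun h => h7 h.symm⟩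

namespace IsQuasiMedianGraph

variable {H K : Hyperplane X}

theorem not_adj_of_dist (hX : IsQuasiMedianGraph X) (u : V) {a b : V}
    (h : X.dist u a + 2 ≤ X.dist u b) : ¬ X.Adj a b := fun hab => by
  have := hX.dist_le_succ_of_adj u hab.symm
  omega

/-- A tie between `a` and `c` would give a vertex below the edge `ac`. With `b` it forms two
triangles on `ac`, hence an edge between levels two apart. -/
theorem dist_lt_of_triangle (hX : IsQuasiMedianGraph X) {u a b c : V} (hab : X.Adj a b)
    (hac : X.Adj a c) (hbc : X.Adj b c) (h : X.dist u a < X.dist u b) :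
    X.dist u a < X.dist u c := by
  by_contra hc
  have h1 := hX.dist_le_succ_of_adj u hab.symm
  have h2 := hX.dist_le_succ_of_adj u hbc
  obtain ⟨e, hea, hec, he⟩ := hX.exists_triangle (u := u) hac (by omega)
  have hne : b ≠ e := fun h' => by rw [← h'] at he; omega
  exact hX.not_adj_of_dist u (by omega)
    (hX.no_K4_minus a c b e hac hab hea.symm hbc.symm hec.symm hne).symm

/-- An edge whose endpoints lie on different sides of an edge is dual to the same hyperplane. -/
theorem isDual_of_dist_lt (hX : IsQuasiMedianGraph X) {u v : V} (huv : X.Adj u v) :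
    ∀ (n : ℕ) {x y : V}, X.dist u x = n → IsDual X H x y → X.dist u x < X.dist u y →
      ¬ X.dist v x < X.dist v y → IsDual X H u v := by
  have a1 : ∀ z, X.dist v z ≤ X.dist u z + 1 := fun z => by
    have := hX.dist_le_succ_of_adj z huv.symm
    rwa [SimpleGraph.dist_comm, SimpleGraph.dist_comm (v := u)] at this
  have a2 : ∀ z, X.dist u z ≤ X.dist v z + 1 := fun z => by
    have := hX.dist_le_succ_of_adj z huv
    rwa [SimpleGraph.dist_comm, SimpleGraph.dist_comm (v := v)] at this
  -- Move `x` one step towards `u`; the quadrangle condition seen from `v` completes a square whose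
  -- opposite side is dual to `H` and nearer. This ladder of squares descends to `uv`.
  have far : ∀ n : ℕ, ∀ {x y : V}, X.dist u x = n → IsDual X H x y → X.dist u x < X.dist u y →
      X.dist v y < X.dist v x → IsDual X H u v := by
    intro n
    induction n with
    | zero =>
      intro x y hn hxy h1 h2
      rw [hX.connected.dist_eq_zero_iff] at hn
      subst hn
      have b1 := hX.dist_le_succ_of_adj u hxy.adj.symm
      rw [SimpleGraph.dist_self] at b1
      have b2 := a1 u
      rw [SimpleGraph.dist_self] at b2
      have : X.dist v y = 0 := by omega
      rw [hX.connected.dist_eq_zero_iff] at this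
      subst this
      exact hxy
    | succ n ih =>
      intro x y hn hxy h1 h2
      have b1 := hX.dist_le_succ_of_adj u hxy.adj.symm
      have c1 := a1 x
      have c2 := a2 y
      obtain ⟨W, hW⟩ := hX.connected.exists_walk_length_eq_dist x u
      obtain ⟨x', hxx', hx'⟩ : ∃ x', X.Adj x x' ∧ X.dist u x' = n := by
        rw [SimpleGraph.dist_comm, hn] at hW
        match W, hW with
        | .cons hadj W', hW =>
          refine ⟨_, hadj, ?_⟩
          have e1 := SimpleGraph.dist_le W'
          have e2 := hX.dist_le_succ_of_adj u hadj
          rw [SimpleGraph.dist_comm] at e1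
          simp only [SimpleGraph.Walk.length_cons] at hW
          omega
      have c3 := a1 x'
      have c4 := hX.dist_le_succ_of_adj v hxx'
      have hx'y : ¬ X.Adj x' y := hX.not_adj_of_dist u (by omega)
      have hne : x' ≠ y := fun h => by rw [h] at hx'; omega
      obtain ⟨y', hy'x', hy'y, hy'⟩ := hX.exists_quadrangle (u := v) hxx' hxy.adj hne hx'y
        (by omega) (by omega)
      have c5 := a2 y'
      have c6 := hX.dist_le_succ_of_adj u hy'y.symm
      have hxy' : ¬ X.Adj y' x := hX.not_adj_of_dist v (by omega)
      have hne' : x ≠ y' := fun h => by rw [← h] at hy'; omega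
      have hs : IsInducedSquare X x y y' x' :=
        ⟨hxy.adj, hy'y.symm, hy'x', hxx'.symm, hne', hne.symm, fun h => hxy' h.symm,
          fun h => hx'y h.symm⟩
      exact ih hx' (hxy.square hs) (by omega) (by omega)
  intro n x y hn hxy h1 h2
  rcases lt_trichotomy (X.dist v y) (X.dist v x) with h3 | h3 | h3
  · exact far n hn hxy h1 h3
  -- If `v` is equidistant from `x` and `y`, the edge `xz` of a triangle with apex `z` nearer to `v`
  -- replaces `xy`.
  · obtain ⟨z, hzx, hzy, hz⟩ := hX.exists_triangle (u := v) hxy.adj h3.symm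
    have h4 := hX.dist_lt_of_triangle hxy.adj hzx.symm hzy.symm h1
    exact far n hn (hxy.triangle hzx.symm hzy.symm) h4 (by omega)
  · exact absurd h3 h2

theorem sameSide_of_adj (hX : IsQuasiMedianGraph X) {u v : V} (huv : X.Adj u v)
    (h : ¬ IsDual X H u v) : SameSide X H u v := by
  intro x y hxy
  constructor
  · intro h1
    by_contra h2
    exact h (hX.isDual_of_dist_lt huv _ rfl hxy h1 h2)
  · intro h1
    by_contra h2
    exact h (hX.isDual_of_dist_lt huv.symm _ rfl hxy h1 h2).symm

/-- The carrier of a hyperplane lies on one side of every other hyperplane that it does not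
cross. -/
theorem sameSide_of_mem_carrier (hX : IsQuasiMedianGraph X) (hne : K ≠ H) (hc : ¬ Crosses X K H)
    {u v : V} (hu : u ∈ carrier X K) (hv : v ∈ carrier X K) : SameSide X H u v := by
  have edge : ∀ e : X.edgeSet, dualHyperplane X e = K → ∀ a ∈ (e : Sym2 V), ∀ b ∈ (e : Sym2 V),
      SameSide X H a b := by
    rintro ⟨e, he⟩ hK a ha b hb
    by_cases hab : a = b
    · subst hab
      exact .refl _
    · have : e = s(a, b) := ((Sym2.mem_and_mem_iff hab).1 ⟨ha, hb⟩)
      subst this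
      exact hX.sameSide_of_adj he fun h => hne (IsDual.eq ⟨he, hK⟩ h)
  have key : ∀ e f : X.edgeSet, Relation.EqvGen (ElemParallel X) e f → dualHyperplane X e = K →
      ∀ a ∈ (e : Sym2 V), ∀ b ∈ (f : Sym2 V), SameSide X H a b := by
    intro e f h
    induction h with
    | rel e f h =>
      intro hK
      have hfK : dualHyperplane X f = K := by
        rw [← hK]
        exact (Quotient.sound (Relation.EqvGen.rel _ _ h)).symm
      have glue : ∀ x ∈ (e : Sym2 V), ∀ y ∈ (f : Sym2 V), SameSide X H x y →
          ∀ a ∈ (e : Sym2 V), ∀ b ∈ (f : Sym2 V), SameSide X H a b :=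
        fun x hx y hy hxy a ha b hb =>
          ((edge e hK a ha x hx).trans hxy).trans (edge f hfK y hy b hb)
      rcases h with ⟨a, b, c, -, -, -, he, hf⟩ | ⟨a, b, c, d, hs, he, hf⟩
      · exact glue a (by simp [he]) a (by simp [hf]) (.refl _)
      -- If the transverse side `ad` were dual to `H`, this very square would make `K` and `H`
      -- cross.
      · refine glue a (by simp [he]) d (by simp [hf])
          (hX.sameSide_of_adj hs.2.2.2.1.symm fun hd => hc ?_)
        exact crosses_iff.2 ⟨a, b, c, d, hs, .of_edge he hK, hd⟩
    | refl e => exact edge e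
    | symm e f h ih =>
      intro hK a ha b hb
      refine (ih ?_ b hb a ha).symm
      rw [← hK]
      exact Quotient.sound h
    | trans e f g h1 h2 ih1 ih2 =>
      intro hK a ha b hb
      obtain ⟨x, hx⟩ : ∃ x, x ∈ (f : Sym2 V) := ⟨_, Sym2.out_fst_mem _⟩
      refine (ih1 hK a ha x hx).trans (ih2 ?_ x hx b hb)
      rw [← hK]
      exact (Quotient.sound h1).symm
  obtain ⟨e, he, hue⟩ := hu
  obtain ⟨f, hf, hvf⟩ := hv
  exact key e f (Quotient.exact (he.trans hf.symm)) he u hue v hvf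

/-! ### Cliques and gates -/

/-- Two triangles on a common edge complete to a `K₄`, which is why each edge lies in a single
maximal clique. -/
theorem adj_of_mem_edgeClique (hX : IsQuasiMedianGraph X) {a b x y : V} (hab : X.Adj a b)
    (hx : x ∈ edgeClique X a b) (hy : y ∈ edgeClique X a b) (hxy : x ≠ y) : X.Adj x y := by
  obtain ⟨hx1, hx2⟩ := hx
  obtain ⟨hy1, hy2⟩ := hy
  rcases hx1 with rfl | hx1
  · rcases hy1 with rfl | hy1
    · exact absurd rfl hxy
    · exact hy1.symm
  rcases hx2 with rfl | hx2
  · rcases hy2 with rfl | hy2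
    · exact absurd rfl hxy
    · exact hy2.symm
  rcases hy1 with rfl | hy1
  · exact hx1
  rcases hy2 with rfl | hy2
  · exact hx2
  exact hX.no_K4_minus a b x y hab hx1.symm hy1.symm hx2.symm hy2.symm hxy

theorem mem_edgeClique_of_adj (hX : IsQuasiMedianGraph X) {a b x y z : V} (hab : X.Adj a b)
    (hx : x ∈ edgeClique X a b) (hy : y ∈ edgeClique X a b) (hxy : x ≠ y) (hzx : X.Adj z x)
    (hzy : X.Adj z y) : z ∈ edgeClique X a b := by
  have hadj := hX.adj_of_mem_edgeClique hab hx hy hxy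
  have key : ∀ c ∈ edgeClique X a b, z = c ∨ X.Adj z c := by
    intro c hc
    by_cases hcx : c = x
    · exact Or.inr (hcx ▸ hzx)
    by_cases hcy : c = y
    · exact Or.inr (hcy ▸ hzy)
    by_cases hzc : z = c
    · exact Or.inl hzc
    exact Or.inr (hX.no_K4_minus x y z c hadj hzx.symm
      (hX.adj_of_mem_edgeClique hab hx hc (Ne.symm hcx)) hzy.symm
      (hX.adj_of_mem_edgeClique hab hy hc (Ne.symm hcy)) hzc)
  exact ⟨key a (left_mem_edgeClique hab), key b (right_mem_edgeClique hab)⟩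

theorem edgeClique_subset (hX : IsQuasiMedianGraph X) {a b x y : V} (hab : X.Adj a b)
    (hx : x ∈ edgeClique X a b) (hy : y ∈ edgeClique X a b) (hxy : x ≠ y) :
    edgeClique X x y ⊆ edgeClique X a b := by
  rintro z ⟨rfl | hzx, rfl | hzy⟩
  · exact hx
  · exact hx
  · exact hy
  · exact hX.mem_edgeClique_of_adj hab hx hy hxy hzx hzy

theorem edgeClique_eq (hX : IsQuasiMedianGraph X) {a b x y : V} (hab : X.Adj a b)
    (hx : x ∈ edgeClique X a b) (hy : y ∈ edgeClique X a b) (hxy : x ≠ y) :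
    edgeClique X x y = edgeClique X a b := by
  refine (hX.edgeClique_subset hab hx hy hxy).antisymm fun z hz => ?_
  have key : ∀ c ∈ edgeClique X a b, z = c ∨ X.Adj z c := fun c hc =>
    or_iff_not_imp_left.2 fun h => hX.adj_of_mem_edgeClique hab hz hc h
  exact ⟨key x hx, key y hy⟩

theorem isDual_of_mem_edgeClique (hX : IsQuasiMedianGraph X) {a b x y : V} (h : IsDual X H a b)
    (hx : x ∈ edgeClique X a b) (hy : y ∈ edgeClique X a b) (hxy : x ≠ y) : IsDual X H x y := by
  have key : ∀ {a b z}, IsDual X H a b → z ∈ edgeClique X a b → z ≠ a → IsDual X H a z := by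
    intro a b z h hz hza
    rcases hz.2 with rfl | hzb
    · exact h
    · exact h.triangle (hz.1.resolve_left hza).symm hzb.symm
  by_cases hxa : x = a
  · subst hxa
    exact key h hy hxy.symm
  · have h1 := (key h hx hxa).symm
    refine key h1 ?_ hxy.symm
    rw [hX.edgeClique_eq h.adj hx (left_mem_edgeClique h.adj) hxa]
    exact hy

/-- A tie for the minimum would give, by the triangle condition, a nearer vertex adjacent to two
members of the clique, hence in the clique. -/
theorem exists_isGate (hX : IsQuasiMedianGraph X) {a b : V} (hab : X.Adj a b) (u : V) :
    ∃ g, IsGate X a b u g := by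
  obtain ⟨g, hg, hmin⟩ := (measure fun z => X.dist u z).wf.has_min (edgeClique X a b)
    ⟨a, left_mem_edgeClique hab⟩
  refine ⟨g, hg, fun z hz hzg => lt_of_not_ge fun hle => ?_⟩
  have h1 : ¬ X.dist u z < X.dist u g := hmin z hz
  have hadj := hX.adj_of_mem_edgeClique hab hz hg hzg
  obtain ⟨x, hxz, hxg, hx⟩ := hX.exists_triangle (u := u) hadj (by omega)
  have h2 : ¬ X.dist u x < X.dist u g :=
    hmin x (hX.mem_edgeClique_of_adj hab hz hg hzg hxz hxg)
  omega

theorem isGate_of_sameSide (hX : IsQuasiMedianGraph X) {a b u v g : V} (hab : IsDual X H a b)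
    (h : SameSide X H u v) (hg : IsGate X a b u g) : IsGate X a b v g :=
  ⟨hg.1, fun z hz hzg =>
    (h g z (hX.isDual_of_mem_edgeClique hab hg.1 hz hzg.symm)).1 (hg.2 z hz hzg)⟩

/-- Opposite sides of a square separate the vertices in the same way. -/
theorem dist_lt_of_square (hX : IsQuasiMedianGraph X) {a b c d u : V}
    (hs : IsInducedSquare X a b c d) (h : X.dist u a < X.dist u b) :
    X.dist u d < X.dist u c := by
  obtain ⟨hab, hbc, hcd, hda, hac, hbd, nac, nbd⟩ := hs
  have h1 := hX.dist_le_succ_of_adj u hab.symm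
  have h2 := hX.dist_le_succ_of_adj u hda
  have h3 := hX.dist_le_succ_of_adj u hda.symm
  have h4 := hX.dist_le_succ_of_adj u hbc
  have h5 := hX.dist_le_succ_of_adj u hcd
  have h6 := hX.dist_le_succ_of_adj u hcd.symm
  by_contra hcon
  -- Otherwise `c` is level with `a`, or level with both `b` and `d`. Either way an induced
  -- `K_{2,3}` arises: `a, c` against `b, d, f`, or `a, e` against `m, d, f`.
  by_cases hck : X.dist u c = X.dist u a
  · obtain ⟨f, hfa, hfc, hf⟩ := hX.exists_quadrangle (u := u) hab.symm hbc hac nac (by omega)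
      (by omega)
    have hbf : b ≠ f := fun h => by rw [← h] at hf; omega
    have hdf : d ≠ f := fun h => by rw [← h] at hf; omega
    have nbf : ¬ X.Adj f b := hX.not_adj_of_dist u (by omega)
    have ndf : ¬ X.Adj d f := fun hdf' =>
      nac (hX.no_K4_minus d f a c hdf' hda hcd.symm hfa hfc hac)
    exact hac (hX.eq_of_common_neighbors hab hda.symm hfa.symm hbc.symm hcd hfc.symm hbd hbf hdf
      nbd (fun h => nbf h.symm) ndf)
  · obtain ⟨e, hec, hed, he⟩ := hX.exists_triangle (u := u) hcd (by omega)
    have hae : a ≠ e := fun h => nac (h ▸ hec)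
    have nae : ¬ X.Adj a e := fun h => nac (hX.no_K4_minus d e a c hed.symm hda hcd.symm h.symm
      hec hac)
    have hbe : b ≠ e := fun h => nbd (h ▸ hed)
    have nbe : ¬ X.Adj b e := fun h => nbd (hX.no_K4_minus c e b d hec.symm hbc.symm hcd h.symm
      hed hbd)
    have e1 := hX.dist_eq_two hed.symm hda hae.symm fun h => nae h.symm
    have e2 := hX.dist_eq_two hec.symm hbc.symm hbe.symm fun h => nbe h.symm
    obtain ⟨m, hma, hmb, hm⟩ := hX.exists_triangle (u := e) hab (by omega)
    have hme : X.Adj e m := SimpleGraph.dist_eq_one_iff_adj.1 (by omega)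
    have e3 := hX.dist_lt_of_triangle hab hma.symm hmb.symm h
    have e4 := hX.dist_le_succ_of_adj u hma
    obtain ⟨f, hfa, hfe, hf⟩ := hX.exists_quadrangle (u := u) hma hme.symm hae nae (by omega)
      (by omega)
    have hmd : m ≠ d := fun h => nbd (h ▸ hmb.symm)
    have nmd : ¬ X.Adj m d := fun h => nbd
      (hX.no_K4_minus a m b d hma.symm hab hda.symm hmb h hbd)
    have hmf : m ≠ f := fun h => by rw [← h] at hf; omega
    have hdf : d ≠ f := fun h => by rw [← h] at hf; omega
    have nfm : ¬ X.Adj f m := hX.not_adj_of_dist u (by omega)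
    have nfd : ¬ X.Adj f d := hX.not_adj_of_dist u (by omega)
    exact hae (hX.eq_of_common_neighbors hma.symm hda.symm hfa.symm hme hed hfe.symm hmd hmf hdf
      nmd (fun h => nfm h.symm) fun h => nfd h.symm)

/-- A third vertex of the clique is at distance two from both `c` and `d`, so the triangle condition
applies. With the next two lemmas, the cliques on opposite sides of a square are disjoint and
perfectly matched. -/
theorem exists_adj_of_square (hX : IsQuasiMedianGraph X) {a b c d g : V}
    (hs : IsInducedSquare X a b c d) (hg : g ∈ edgeClique X a b) :
    ∃ g' ∈ edgeClique X d c, X.Adj g g' := by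
  obtain ⟨hab, hbc, hcd, hda, hac, hbd, nac, nbd⟩ := hs
  obtain ⟨rfl | hga, rfl | hgb⟩ := hg
  · exact absurd hab (X.irrefl)
  · exact ⟨d, left_mem_edgeClique hcd.symm, hda.symm⟩
  · exact ⟨c, right_mem_edgeClique hcd.symm, hbc⟩
  · have hgc : g ≠ c := fun h => nac (h ▸ hga.symm)
    have ngc : ¬ X.Adj g c := fun h => nac
      (hX.no_K4_minus b g a c hgb.symm hab.symm hbc hga h hac)
    have hgd : g ≠ d := fun h => nbd (h ▸ hgb.symm)
    have ngd : ¬ X.Adj g d := fun h => nbd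
      (hX.no_K4_minus a g b d hga.symm hab hda.symm hgb h hbd)
    have e1 := hX.dist_eq_two hgb.symm hbc hgc ngc
    have e2 := hX.dist_eq_two hga.symm hda.symm hgd ngd
    obtain ⟨m, hmc, hmd, hm⟩ := hX.exists_triangle (u := g) hcd (by omega)
    exact ⟨m, ⟨Or.inr hmd, Or.inr hmc⟩, SimpleGraph.dist_eq_one_iff_adj.1 (by omega)⟩

theorem disjoint_of_square (hX : IsQuasiMedianGraph X) {a b c d z : V}
    (hs : IsInducedSquare X a b c d) (hz : z ∈ edgeClique X a b) : z ∉ edgeClique X d c := by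
  obtain ⟨hab, hbc, hcd, hda, hac, hbd, nac, nbd⟩ := hs
  rintro ⟨h3, h4⟩
  obtain ⟨h1, h2⟩ := hz
  have hza : X.Adj z a := h1.resolve_left fun h => by
    subst h
    exact h4.elim hac nac
  have hzb : X.Adj z b := h2.resolve_left fun h => by
    subst h
    exact h3.elim hbd nbd
  have hzd : X.Adj z d := h3.resolve_left fun h => nbd (h ▸ hzb.symm)
  exact nbd (hX.no_K4_minus a z b d hza.symm hab hda.symm hzb hzd hbd)

theorem eq_of_adj_of_square (hX : IsQuasiMedianGraph X) {a b c d g x y : V}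
    (hs : IsInducedSquare X a b c d) (hg : g ∈ edgeClique X a b) (hx : x ∈ edgeClique X d c)
    (hy : y ∈ edgeClique X d c) (hgx : X.Adj g x) (hgy : X.Adj g y) : x = y := by
  by_contra hne
  exact hX.disjoint_of_square hs hg
    (hX.mem_edgeClique_of_adj hs.2.2.1.symm hx hy hne hgx hgy)

theorem isInducedSquare_of_edgeClique (hX : IsQuasiMedianGraph X) {a b c d g h g' h' : V}
    (hs : IsInducedSquare X a b c d) (hg : g ∈ edgeClique X a b) (hh : h ∈ edgeClique X a b)
    (hgh : g ≠ h) (hg' : g' ∈ edgeClique X d c) (hh' : h' ∈ edgeClique X d c)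
    (hgg' : X.Adj g g') (hhh' : X.Adj h h') : IsInducedSquare X g h h' g' := by
  have hne : g' ≠ h' := fun h => hgh
    (hX.eq_of_adj_of_square hs.flip hg' hg hh hgg'.symm (h ▸ hhh'.symm))
  refine ⟨hX.adj_of_mem_edgeClique hs.1 hg hh hgh, hhh',
    hX.adj_of_mem_edgeClique hs.2.2.1.symm hh' hg' hne.symm, hgg'.symm, ?_, ?_, ?_, ?_⟩
  · exact fun h => hX.disjoint_of_square hs hg (h ▸ hh')
  · exact fun h => hX.disjoint_of_square hs hh (h ▸ hg')
  · exact fun h => hne (hX.eq_of_adj_of_square hs hg hg' hh' hgg' h)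
  · exact fun h => hne (hX.eq_of_adj_of_square hs hh hg' hh' h hhh')

/-- The matching turns each comparison in one clique into one across a square, where
`dist_lt_of_square` applies. -/
theorem isGate_of_square (hX : IsQuasiMedianGraph X) {a b c d u g g' : V}
    (hs : IsInducedSquare X a b c d) (hg : IsGate X a b u g) (hg' : g' ∈ edgeClique X d c)
    (hgg' : X.Adj g g') : IsGate X d c u g' := by
  refine ⟨hg', fun h' hh' hne => ?_⟩
  obtain ⟨h, hh, hhh'⟩ := hX.exists_adj_of_square hs.flip hh'
  have hgh : g ≠ h := fun e => hne
    (hX.eq_of_adj_of_square hs hg.1 hh' hg' (e ▸ hhh'.symm) hgg')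
  exact hX.dist_lt_of_square
    (hX.isInducedSquare_of_edgeClique hs hg.1 hh hgh hg' hh' hgg' hhh'.symm)
    (hg.2 h hh hgh.symm)

/-- Parallel edges have the same pairs of vertices with a common gate. -/
theorem sameGate_iff (hX : IsQuasiMedianGraph X) {a b c d : V} (hab : IsDual X H a b)
    (hcd : IsDual X H c d) (u v : V) :
    (∃ g, IsGate X a b u g ∧ IsGate X a b v g) ↔ ∃ g, IsGate X c d u g ∧ IsGate X c d v g := by
  have swap : ∀ a b : V, edgeClique X a b = edgeClique X b a := fun a b =>
    Set.ext fun z => and_comm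
  have key : ∀ e f : X.edgeSet, Relation.EqvGen (ElemParallel X) e f →
      ∀ a b c d : V, (e : Sym2 V) = s(a, b) → (f : Sym2 V) = s(c, d) →
      ((∃ g, IsGate X a b u g ∧ IsGate X a b v g) ↔
        ∃ g, IsGate X c d u g ∧ IsGate X c d v g) := by
    -- the common gate only depends on the clique, hence on the unordered edge
    have indep : ∀ a b c d : V, edgeClique X a b = edgeClique X c d →
        ((∃ g, IsGate X a b u g ∧ IsGate X a b v g) ↔
          ∃ g, IsGate X c d u g ∧ IsGate X c d v g) := by
      intro a b c d h
      simp only [IsGate, h]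
    have edge : ∀ a b c d : V, s(a, b) = s(c, d) → edgeClique X a b = edgeClique X c d := by
      intro a b c d h
      rcases Sym2.eq_iff.1 h with ⟨rfl, rfl⟩ | ⟨rfl, rfl⟩
      · rfl
      · exact swap _ _
    intro e f h
    induction h with
    | rel e f h =>
      intro a b c d he hf
      rcases h with ⟨p, q, r, hpq, hqr, hpr, he', hf'⟩ | ⟨p, q, r, s, hs, he', hf'⟩
      · refine indep _ _ _ _ ?_
        rw [edge a b p q (he.symm.trans he'), edge c d p r (hf.symm.trans hf')]
        exact (hX.edgeClique_eq hpq (left_mem_edgeClique hpq) ⟨Or.inr hpr.symm, Or.inr hqr.symm⟩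
          hpr.ne).symm
      · rw [indep a b p q (edge _ _ _ _ (he.symm.trans he')),
          indep c d s r (edge _ _ _ _ (hf.symm.trans hf'))]
        constructor
        · rintro ⟨g, h1, h2⟩
          obtain ⟨g', hg', hgg'⟩ := hX.exists_adj_of_square hs h1.1
          exact ⟨g', hX.isGate_of_square hs h1 hg' hgg', hX.isGate_of_square hs h2 hg' hgg'⟩
        · rintro ⟨g, h1, h2⟩
          obtain ⟨g', hg', hgg'⟩ := hX.exists_adj_of_square hs.flip h1.1
          exact ⟨g', hX.isGate_of_square hs.flip h1 hg' hgg',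
            hX.isGate_of_square hs.flip h2 hg' hgg'⟩
    | refl e =>
      intro a b c d he hf
      exact indep _ _ _ _ (edge _ _ _ _ (he.symm.trans hf))
    | symm e f h ih => exact fun a b c d he hf => (ih c d a b hf he).symm
    | trans e f g h1 h2 ih1 ih2 =>
      intro a b c d he hf
      obtain ⟨p, q, hpq⟩ : ∃ p q, (f : Sym2 V) = s(p, q) := by
        induction (f : Sym2 V) with | _ p q => exact ⟨p, q, rfl⟩
      exact (ih1 a b p q he hpq).trans (ih2 p q c d hpq hf)
  obtain ⟨h1, h2⟩ := hab
  obtain ⟨h3, h4⟩ := hcd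
  exact key _ _ (Quotient.exact (h2.trans h4.symm)) a b c d rfl rfl

/-- Whether two vertices share a gate does not depend on the dual edge, and in the clique of `cd`
both `c` and `d` are their own gates. -/
theorem gate_ne_of_isDual (hX : IsQuasiMedianGraph X) {a b c d g h : V} (hab : IsDual X H a b)
    (hcd : IsDual X H c d) (hg : IsGate X a b c g) (hh : IsGate X a b d h) : g ≠ h := by
  rintro rfl
  obtain ⟨k, h1, h2⟩ := (hX.sameGate_iff hab hcd c d).1 ⟨g, hg, hh⟩
  have zero : ∀ {x : V}, x ∈ edgeClique X c d → IsGate X c d x k → x = k := by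
    intro x hx hk
    by_contra hne
    have := hk.2 x hx hne
    rw [SimpleGraph.dist_self] at this
    omega
  exact hcd.adj.ne ((zero (left_mem_edgeClique hcd.adj) h1).trans
    (zero (right_mem_edgeClique hcd.adj) h2).symm)

/-- Two edges with a common endpoint, dual to distinct hyperplanes that cross, form a corner of an
induced square. -/
theorem exists_square_of_crosses (hX : IsQuasiMedianGraph X) {a b c : V} (hne : H ≠ K)
    (hc : Crosses X H K) (hab : IsDual X H a b) (hac : IsDual X K a c) :
    ∃ d, IsInducedSquare X a b d c := by
  obtain ⟨a', b', c', d', hs, hab', had'⟩ := crosses_iff.1 hc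
  have hdc' : IsDual X H d' c' := hab'.square hs
  have hbc' : IsDual X K b' c' := had'.square hs.reflect
  -- Along a side dual to `H` the gate for `ab` changes while that for `ac` does not; along a side
  -- dual to `K` it is the reverse. So at some corner of the given square both gates differ from
  -- `a`.
  obtain ⟨u, z, z', hz, hz', hza, hz'a⟩ : ∃ u z z', IsGate X a b u z ∧ IsGate X a c u z' ∧
      z ≠ a ∧ z' ≠ a := by
    have sH : ∀ {p q : V}, IsDual X K p q → SameSide X H p q := fun h =>
      hX.sameSide_of_adj h.adj fun h' => hne (h'.eq h)
    have sK : ∀ {p q : V}, IsDual X H p q → SameSide X K p q := fun h =>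
      hX.sameSide_of_adj h.adj fun h' => hne (h.eq h')
    obtain ⟨g₁, hg₁⟩ := hX.exists_isGate hab.adj a'
    obtain ⟨g₂, hg₂⟩ := hX.exists_isGate hab.adj b'
    obtain ⟨k₁, hk₁⟩ := hX.exists_isGate hac.adj a'
    obtain ⟨k₂, hk₂⟩ := hX.exists_isGate hac.adj d'
    have hg := hX.gate_ne_of_isDual hab hab' hg₁ hg₂
    have hk := hX.gate_ne_of_isDual hac had' hk₁ hk₂
    by_cases h1 : g₁ = a
    · by_cases h2 : k₁ = a
      · exact ⟨c', g₂, k₂, hX.isGate_of_sameSide hab (sH hbc') hg₂,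
          hX.isGate_of_sameSide hac (sK hdc') hk₂, h1 ▸ hg.symm, h2 ▸ hk.symm⟩
      · exact ⟨b', g₂, k₁, hg₂, hX.isGate_of_sameSide hac (sK hab') hk₁, h1 ▸ hg.symm, h2⟩
    · by_cases h2 : k₁ = a
      · exact ⟨d', g₁, k₂, hX.isGate_of_sameSide hab (sH had') hg₁, hk₂, h1, h2 ▸ hk.symm⟩
      · exact ⟨a', g₁, k₁, hg₁, hk₁, h1, h2⟩
  have la := left_mem_edgeClique hab.adj
  have la' := left_mem_edgeClique hac.adj
  have haz := hX.isDual_of_mem_edgeClique hab la hz.1 hza.symm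
  have haz' := hX.isDual_of_mem_edgeClique hac la' hz'.1 hz'a.symm
  have hzz : z ≠ z' := fun h => hne (haz.eq (h ▸ haz'))
  have nzz : ¬ X.Adj z z' := fun h => hne ((haz.triangle haz'.adj h).eq haz')
  have d1 := hz.2 a la hza.symm
  have d2 := hz'.2 a la' hz'a.symm
  have d3 := hX.dist_le_succ_of_adj u haz.adj
  have d4 := hX.dist_le_succ_of_adj u haz'.adj
  obtain ⟨w, hwz, hwz', hw⟩ := hX.exists_quadrangle (u := u) haz.adj haz'.adj hzz nzz (by omega)
    (by omega)
  have naw : ¬ X.Adj w a := hX.not_adj_of_dist u (by omega)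
  have haw : a ≠ w := fun h => by rw [← h] at hw; omega
  have s1 : IsInducedSquare X a z w z' := ⟨haz.adj, hwz.symm, hwz', haz'.adj.symm, haw, hzz,
    fun h => naw h.symm, nzz⟩
  -- The square found leaves `a` towards the gates; the matching of opposite cliques swings one side
  -- to `b` and then the other to `c`.
  have hb : b ∈ edgeClique X a z := by
    rw [hX.edgeClique_eq hab.adj la hz.1 hza.symm]
    exact right_mem_edgeClique hab.adj
  obtain ⟨e, he, hbe⟩ := hX.exists_adj_of_square s1 hb
  have s2 : IsInducedSquare X a b e z' := hX.isInducedSquare_of_edgeClique s1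
    (left_mem_edgeClique haz.adj) hb hab.adj.ne (left_mem_edgeClique hwz'.symm) he haz'.adj hbe
  have hc' : c ∈ edgeClique X a z' := by
    rw [hX.edgeClique_eq hac.adj la' hz'.1 hz'a.symm]
    exact right_mem_edgeClique hac.adj
  obtain ⟨f, hf, hcf⟩ := hX.exists_adj_of_square s2.reflect hc'
  exact ⟨f, (hX.isInducedSquare_of_edgeClique s2.reflect (left_mem_edgeClique haz'.adj) hc'
    hac.adj.ne (left_mem_edgeClique hbe) hf hab.adj hcf).reflect⟩

/-! ### Hyperplanes between two carriers -/

/-- A hyperplane that is crossed on a shortest way out of the carrier of `K` neither equals nor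
crosses `K`. -/
theorem ne_and_not_crosses_of_dist (hX : IsQuasiMedianGraph X) {p : V} (hp : p ∈ carrier X K) :
    ∀ (n : ℕ) {H : Hyperplane X} {v w : V}, X.dist p v = n → IsDual X H v w →
      (∀ q ∈ carrier X K, n < X.dist q w) → H ≠ K ∧ ¬ Crosses X H K := by
  intro n
  induction n with
  | zero =>
    intro H v w hn hvw hfar
    rw [hX.connected.dist_eq_zero_iff] at hn
    subst hn
    have hw : w ∉ carrier X K := fun h => by
      have := hfar w h
      rw [SimpleGraph.dist_self] at this
      omega
    have hne : H ≠ K := fun h => hw (mem_carrier_iff.2 ⟨p, h ▸ hvw.symm⟩)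
    refine ⟨hne, fun hc => hw ?_⟩
    obtain ⟨t, ht⟩ := mem_carrier_iff.1 hp
    obtain ⟨s, hs⟩ := hX.exists_square_of_crosses hne hc hvw ht
    exact mem_carrier_iff.2 ⟨s, ht.square hs.reflect⟩
  | succ n ih =>
    intro H v w hn hvw hfar
    by_contra hcon
    have hHK : H = K ∨ Crosses X H K := by
      by_contra h
      exact hcon ⟨fun h' => h (Or.inl h'), fun h' => h (Or.inr h')⟩
    obtain ⟨v', hv', hpv'⟩ : ∃ v', X.Adj v' v ∧ X.dist p v' = n := by
      obtain ⟨W, hW⟩ := hX.connected.exists_walk_length_eq_dist v p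
      rw [SimpleGraph.dist_comm, hn] at hW
      match W, hW with
      | .cons hadj W', hW =>
        refine ⟨_, hadj.symm, ?_⟩
        have e1 := SimpleGraph.dist_le W'
        have e2 := hX.dist_le_succ_of_adj p hadj
        rw [SimpleGraph.dist_comm] at e1
        simp only [SimpleGraph.Walk.length_cons] at hW
        omega
    have hfar' : ∀ q ∈ carrier X K, n < X.dist q v := fun q hq => by
      have h1 := hfar q hq
      have h2 := hX.dist_le_succ_of_adj q hvw.adj.symm
      omega
    set L : Hyperplane X := dualHyperplane X ⟨s(v', v), hv'⟩ with hL
    have hLd : IsDual X L v' v := ⟨hv', rfl⟩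
    obtain ⟨hLK, hLc⟩ := ih hpv' hLd hfar'
    have hLH : L ≠ H := by
      rintro h
      rcases hHK with h' | h'
      · exact hLK (h.trans h')
      · exact hLc (h ▸ h')
    -- Otherwise `L` separates neither `p` from a vertex `q` of both carriers nor `q` from `v`,
    -- although it is dual to the last edge of a geodesic from `p` to `v`.
    have hcross : Crosses X L H := by
      by_contra hnc
      obtain ⟨q, hqH, hqK⟩ : (carrier X H ∩ carrier X K).Nonempty := by
        rcases hHK with rfl | h
        · rw [Set.inter_self]
          exact ⟨p, hp⟩
        · exact h.carrier_inter
      have h1 := hX.sameSide_of_mem_carrier hLK.symm (fun h => hLc h.symm) hp hqK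
      have h2 := hX.sameSide_of_mem_carrier hLH.symm (fun h => hnc h.symm) hqH
        (mem_carrier_iff.2 ⟨w, hvw⟩)
      have h3 := (h1.trans h2 v' v hLd).1 (by omega)
      rw [SimpleGraph.dist_self] at h3
      omega
    -- Crossing this square in the other order meets `H` already at `v'`, where the induction
    -- hypothesis excludes it.
    obtain ⟨s, hs⟩ := hX.exists_square_of_crosses hLH hcross hLd.symm hvw
    have hHs : IsDual X H v' s := hvw.square hs.reflect
    refine (ih hpv' hHs fun q hq => ?_).elim fun h1 h2 => hHK.elim h1 h2
    have h1 := hfar q hq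
    have h2 := hX.dist_le_succ_of_adj q hs.2.2.1.symm
    omega

/-- A shortest path between two carriers only crosses hyperplanes that separate them. -/
theorem separates_of_dist (hX : IsQuasiMedianGraph X) {K L : Hyperplane X} {p q v w : V}
    (hp : p ∈ carrier X K) (hq : q ∈ carrier X L)
    (hmin : ∀ p' ∈ carrier X K, ∀ q' ∈ carrier X L, X.dist p q ≤ X.dist p' q')
    (hH : IsDual X H v w) (hgeo : X.dist p v + 1 + X.dist w q = X.dist p q) :
    Separates X H K L := by
  have t : ∀ a b c : V, X.dist a c ≤ X.dist a b + X.dist b c := fun a b c =>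
    hX.connected.dist_triangle
  have c : ∀ a b : V, X.dist a b = X.dist b a := fun a b => SimpleGraph.dist_comm
  have hK := hX.ne_and_not_crosses_of_dist hp _ rfl hH fun p' hp' => by
    have h1 := hmin p' hp' q hq
    have h2 := t p' w q
    omega
  have hL := hX.ne_and_not_crosses_of_dist hq _ rfl hH.symm fun q' hq' => by
    have h1 := hmin p hp q' hq'
    have h2 := t p v q'
    have h3 := c q' v
    have h4 := c q w
    omega
  refine ⟨hK, hL, fun a ha b hb hab => ?_⟩
  have h1 := hX.sameSide_of_mem_carrier hK.1.symm (fun h => hK.2 h.symm) hp ha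
  have h2 := hX.sameSide_of_mem_carrier hL.1.symm (fun h => hL.2 h.symm) hb hq
  refine SameSide.not_of_dist hH ?_ ?_ ((h1.trans hab).trans h2)
  · have := t p w q
    omega
  · have h3 := t p v q
    have h4 := c q w
    have h5 := c q v
    omega

/-- A hyperplane that crosses `K` and `L` crosses every hyperplane that separates them. -/
theorem crosses_of_separates (hX : IsQuasiMedianGraph X) {G H K L : Hyperplane X}
    (h : Separates X H K L) (hK : Crosses X G K) (hL : Crosses X G L) : G ≠ H ∧ Crosses X G H := by
  obtain ⟨⟨-, h1⟩, -, h2⟩ := h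
  have hne : G ≠ H := fun h => h1 (h ▸ hK)
  refine ⟨hne, by_contra fun hc => ?_⟩
  -- The carrier of `G` meets those of `K` and `L`; if `G` did not cross `H`, it would stay on one
  -- side of `H`.
  obtain ⟨p, hp1, hp2⟩ := hK.carrier_inter
  obtain ⟨q, hq1, hq2⟩ := hL.carrier_inter
  exact h2 p hp2 q hq2 (hX.sameSide_of_mem_carrier hne hc hp1 hq1)

end IsQuasiMedianGraph

/-! ### Layering trees -/

section ParentTree

variable {T : Type u} (par : T → T) (lvl : T → ℕ)

/-- The graph that joins each element of positive level to its parent. -/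
def parentGraph : SimpleGraph T where
  Adj s t := (0 < lvl s ∧ lvl t + 1 = lvl s ∧ t = par s) ∨
    (0 < lvl t ∧ lvl s + 1 = lvl t ∧ s = par t)
  symm := ⟨fun _ _ h => h.symm⟩
  loopless := ⟨fun _ h => by omega⟩

variable {par lvl}

theorem parentGraph_adj (hlvl : ∀ t, lvl t ≠ 0 → lvl (par t) + 1 = lvl t) {t : T}
    (ht : lvl t ≠ 0) : (parentGraph par lvl).Adj t (par t) :=
  Or.inl ⟨Nat.pos_of_ne_zero ht, hlvl t ht, rfl⟩

/-- Following parents leads to the root, and the edge from `t` to its parent is a bridge because it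
alone leaves the set of descendants of `t`. -/
theorem parentGraph_isTree (hlvl : ∀ t, lvl t ≠ 0 → lvl (par t) + 1 = lvl t) (r : T)
    (hr : ∀ t, lvl t = 0 ↔ t = r) : (parentGraph par lvl).IsTree := by
  have hreach : ∀ (n : ℕ) (t : T), lvl t = n → (parentGraph par lvl).Reachable t r := by
    intro n
    induction n with
    | zero =>
      intro t ht
      rw [(hr t).1 ht]
    | succ n ih =>
      intro t ht
      have h := hlvl t (by omega)
      exact (parentGraph_adj hlvl (by omega)).reachable.trans (ih _ (by omega))
  have : Nonempty T := ⟨r⟩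
  refine ⟨⟨fun s t => (hreach _ s rfl).trans (hreach _ t rfl).symm⟩, ?_⟩
  have bridge : ∀ t, lvl t ≠ 0 → (parentGraph par lvl).IsBridge s(t, par t) := by
    intro t ht
    rw [SimpleGraph.isBridge_iff]
    -- removing the edge isolates the descendants of `t`
    rintro ⟨W⟩
    have key : ∀ {x y : T}, ((parentGraph par lvl).deleteEdges {s(t, par t)}).Walk x y →
        (∃ k, par^[k] x = t ∧ lvl x = lvl t + k) → ∃ k, par^[k] y = t ∧ lvl y = lvl t + k := by
      intro x y W
      induction W with
      | nil => exact id
      | @cons x z y hadj W ih =>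
        rintro ⟨k, hk, hk'⟩
        apply ih
        rw [SimpleGraph.deleteEdges_adj] at hadj
        obtain ⟨⟨h1, h2, h3⟩ | ⟨h1, h2, h3⟩, hne⟩ := hadj
        · cases k with
          | zero =>
            simp only [Function.iterate_zero, id] at hk
            subst hk h3
            exact absurd rfl hne
          | succ k =>
            rw [Function.iterate_succ_apply, ← h3] at hk
            exact ⟨k, hk, by omega⟩
        · exact ⟨k + 1, by rw [Function.iterate_succ_apply, ← h3, hk], by omega⟩
    obtain ⟨k, -, hk⟩ := key W ⟨0, rfl, rfl⟩
    have := hlvl t ht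
    omega
  rw [SimpleGraph.isAcyclic_iff_forall_isBridge]
  intro e
  induction e with | _ s t =>
  rintro (⟨h1, h2, h3⟩ | ⟨h1, h2, h3⟩)
  · dsimp only at h1 h2 h3
    subst h3
    exact bridge s (by omega)
  · dsimp only at h1 h2 h3
    subst h3
    rw [Sym2.eq_swap]
    exact bridge t (by omega)

/-- The endpoints of a walk in a parent graph have ancestors in common, no further away than the
walk is long. -/
theorem exists_common_ancestor {s t : T} (W : (parentGraph par lvl).Walk s t) :
    ∃ j k, j + k ≤ W.length ∧ par^[j] s = par^[k] t := by
  induction W with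
  | nil => exact ⟨0, 0, by simp, rfl⟩
  | @cons s z t hadj W ih =>
    obtain ⟨j, k, hjk, h⟩ := ih
    rw [SimpleGraph.Walk.length_cons]
    rcases hadj with ⟨-, -, rfl⟩ | ⟨-, -, rfl⟩
    · exact ⟨j + 1, k, by omega, h⟩
    · cases j with
      | zero => exact ⟨0, k + 1, by omega, by rw [Function.iterate_succ_apply', ← h]; rfl⟩
      | succ j => exact ⟨j, k, by omega, h⟩

end ParentTree

/-! ### Bottlenecks, clusters and the quasi-tree criterion. -/

variable {U : Type u} {G : SimpleGraph U}

/-- Any two vertices are joined by a walk that stays within `δ` of every other walk joining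
them. -/
def HasBottlenecks (G : SimpleGraph U) (δ : ℕ) : Prop :=
  ∀ x y, ∃ P : G.Walk x y, ∀ z ∈ P.support, ∀ W : G.Walk x y, ∃ w ∈ W.support, G.dist z w ≤ δ

/-- `u` and `v` are at the same distance from `o` and are joined outside the open ball of that
radius. -/
def SameCluster (G : SimpleGraph U) (o u v : U) : Prop :=
  G.dist o u = G.dist o v ∧ ∃ W : G.Walk u v, ∀ w ∈ W.support, G.dist o u ≤ G.dist o w

/-- The layers of `G` around `o`, decomposed into clusters. -/
def clusterSetoid (G : SimpleGraph U) (o : U) : Setoid U where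
  r := SameCluster G o
  iseqv := by
    refine ⟨fun u => ⟨rfl, .nil, by simp⟩, ?_, ?_⟩
    · rintro u v ⟨h, W, hW⟩
      refine ⟨h.symm, W.reverse, fun w hw => ?_⟩
      rw [SimpleGraph.Walk.support_reverse, List.mem_reverse] at hw
      exact h ▸ hW w hw
    · rintro u v w ⟨h, W, hW⟩ ⟨h', W', hW'⟩
      refine ⟨h.trans h', W.append W', fun z hz => ?_⟩
      rcases (SimpleGraph.Walk.mem_support_append_iff _ _).1 hz with hz | hz
      · exact hW z hz
      · exact h ▸ hW' z hz

/-- Along a walk from `u` to `v` whose vertices are within `r` of `u` or of `v`, some edge passes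
from the ball around `u` to the ball around `v`. -/
theorem dist_le_of_walk_near (hG : G.Connected) {u : U} {r : ℕ} :
    ∀ {x v : U} (P : G.Walk x v), G.dist u x ≤ r →
      (∀ z ∈ P.support, G.dist u z ≤ r ∨ G.dist v z ≤ r) → G.dist u v ≤ 2 * r + 1 := by
  intro x v P
  induction P with
  | nil =>
    intro h _
    omega
  | @cons x z v hadj P ih =>
    intro hx hP
    by_cases hz : G.dist u z ≤ r
    · exact ih hz fun w hw => hP w (by simp [hw])
    · have h1 := (hP z (by simp)).resolve_left hz
      have h2 := hG.dist_triangle (u := u) (v := x) (w := v)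
      have h3 := hG.dist_triangle (u := x) (v := z) (w := v)
      rw [SimpleGraph.dist_eq_one_iff_adj.2 hadj, SimpleGraph.dist_comm (u := z)] at h3
      omega

theorem dist_of_mem_geodesic (hG : G.Connected) {o u t : U} {W : G.Walk o u}
    (hW : W.length = G.dist o u) (ht : t ∈ W.support) :
    G.dist o t + G.dist t u = G.dist o u := by
  classical
  have h1 := SimpleGraph.dist_le (W.takeUntil t ht)
  have h2 := SimpleGraph.dist_le (W.dropUntil t ht)
  have h3 := congrArg SimpleGraph.Walk.length (W.take_spec ht)
  rw [SimpleGraph.Walk.length_append] at h3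
  have h4 := hG.dist_triangle (u := o) (v := t) (w := u)
  omega

/-- A vertex of the bottleneck path is within `δ` of the outer walk, so at most `δ` inside the
sphere. It is also within `δ` of the route through `o` along two geodesics, at a point then within
`2 * δ` of `u` or `v`. So the path stays within `3 * δ` of its ends. -/
theorem HasBottlenecks.dist_le_of_sameCluster (hG : G.Connected) {δ : ℕ}
    (h : HasBottlenecks G δ) {o u v : U} (huv : SameCluster G o u v) :
    G.dist u v ≤ 6 * δ + 1 := by
  obtain ⟨heq, W, hW⟩ := huv
  obtain ⟨P, hP⟩ := h u v
  obtain ⟨A, hA⟩ := hG.exists_walk_length_eq_dist o u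
  obtain ⟨B, hB⟩ := hG.exists_walk_length_eq_dist o v
  have t : ∀ a b c : U, G.dist a c ≤ G.dist a b + G.dist b c := fun a b c => hG.dist_triangle
  have c : ∀ a b : U, G.dist a b = G.dist b a := fun a b => SimpleGraph.dist_comm
  have := dist_le_of_walk_near hG (u := u) (r := 3 * δ) P (by simp) fun z hz => ?_
  · omega
  obtain ⟨w, hw, hzw⟩ := hP z hz W
  have h1 := hW w hw
  obtain ⟨s, hs, hzs⟩ := hP z hz (A.reverse.append B)
  have e1 := t o z w
  have e2 := t o s z
  have e3 := c s z
  rcases (SimpleGraph.Walk.mem_support_append_iff _ _).1 hs with hs | hs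
  · rw [SimpleGraph.Walk.support_reverse, List.mem_reverse] at hs
    have e4 := dist_of_mem_geodesic hG hA hs
    have e5 := t u s z
    have e6 := c u s
    left
    omega
  · have e4 := dist_of_mem_geodesic hG hB hs
    have e5 := t v s z
    have e6 := c v s
    right
    omega

/-- Predecessors of one cluster lie in one cluster, so clusters have parents and form a tree.
Projection to it is 1-Lipschitz and shortens distances by at most the diameter of a cluster. -/
theorem HasBottlenecks.isQuasiTreeWith [Nonempty U] {δ : ℕ} (h : HasBottlenecks G δ) :
    IsQuasiTreeWith 1 (6 * δ + 1) G := by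
  classical
  have hG : G.Connected := ⟨fun x y => ⟨(h x y).choose⟩⟩
  obtain ⟨o⟩ := ‹Nonempty U›
  have hpred : ∀ v, ∃ w, v ≠ o → G.Adj w v ∧ G.dist o w + 1 = G.dist o v := by
    intro v
    by_cases hv : v = o
    · exact ⟨v, fun h => absurd hv h⟩
    obtain ⟨W, hW⟩ := hG.exists_walk_length_eq_dist v o
    match W, hW with
    | .nil, _ => exact absurd rfl hv
    | .cons (v := w) hadj W', hW =>
      refine ⟨w, fun _ => ⟨hadj.symm, ?_⟩⟩
      have e1 := SimpleGraph.dist_le W'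
      have e2 := hG.dist_triangle (u := o) (v := w) (w := v)
      rw [SimpleGraph.dist_eq_one_iff_adj.2 hadj.symm] at e2
      rw [SimpleGraph.dist_comm] at e1
      rw [SimpleGraph.dist_comm] at hW
      simp only [SimpleGraph.Walk.length_cons] at hW
      omega
  choose pred₀ hpred₀ using hpred
  -- The base vertex is its own predecessor, so every application of `pred` moves a vertex by at
  -- most one.
  set pred : U → U := fun v => if v = o then o else pred₀ v with hpred
  have pred_adj : ∀ v, v ≠ o → G.Adj (pred v) v ∧ G.dist o (pred v) + 1 = G.dist o v := by
    intro v hv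
    simp only [hpred, if_neg hv]
    exact hpred₀ v hv
  have pred_o : pred o = o := if_pos rfl
  have pos : ∀ v, G.dist o v = 0 ↔ v = o := fun v => by
    rw [hG.dist_eq_zero_iff, eq_comm]
  -- the clusters, their levels and their parents
  let S := clusterSetoid G o
  let lvl : Quotient S → ℕ := Quotient.lift (fun v => G.dist o v) fun u v huv => huv.1
  have hpar : ∀ u v, SameCluster G o u v → SameCluster G o (pred u) (pred v) := by
    rintro u v ⟨heq, W, hW⟩
    by_cases hu : u = o
    · have hv : v = o := by
        rw [← pos, ← heq, hu, SimpleGraph.dist_self]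
      rw [hu, hv]
      exact S.refl _
    · have hv : v ≠ o := by
        rwa [Ne, ← pos, ← heq, pos]
      obtain ⟨u1, u2⟩ := pred_adj u hu
      obtain ⟨v1, v2⟩ := pred_adj v hv
      refine ⟨by omega, .cons u1 (W.append (.cons v1.symm .nil)), fun w hw => ?_⟩
      simp only [SimpleGraph.Walk.support_cons, List.mem_cons,
        SimpleGraph.Walk.mem_support_append_iff, SimpleGraph.Walk.support_nil,
        List.not_mem_nil, or_false] at hw
      rcases hw with rfl | hw | rfl | rfl
      · rfl
      · have := hW w hw
        omega
      · omega
      · omega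
  let par : Quotient S → Quotient S := Quotient.map pred hpar
  have par_mk : ∀ v, par (Quotient.mk S v) = Quotient.mk S (pred v) := fun _ => rfl
  have lvl_mk : ∀ v, lvl (Quotient.mk S v) = G.dist o v := fun _ => rfl
  have hlvl : ∀ t, lvl t ≠ 0 → lvl (par t) + 1 = lvl t := by
    intro t
    induction t using Quotient.inductionOn with | _ v =>
    intro hv
    rw [par_mk, lvl_mk, lvl_mk]
    exact (pred_adj v fun h => hv ((pos v).2 h)).2
  have hroot : ∀ t, lvl t = 0 ↔ t = Quotient.mk S o := by
    intro t
    induction t using Quotient.inductionOn with | _ v =>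
    rw [lvl_mk]
    constructor
    · intro h
      rw [(pos v).1 h]
    · intro h
      rw [← lvl_mk, h, lvl_mk, SimpleGraph.dist_self]
  have htree : (parentGraph par lvl).IsTree := parentGraph_isTree hlvl _ hroot
  -- the projection to the tree does not increase distances
  have hstep : ∀ u v, G.Adj u v → (parentGraph par lvl).dist (Quotient.mk S u) (Quotient.mk S v)
      ≤ 1 := by
    have up : ∀ u v, G.Adj u v → G.dist o u + 1 = G.dist o v →
        (parentGraph par lvl).Adj (Quotient.mk S v) (Quotient.mk S u) := by
      intro u v huv hd
      have hv : v ≠ o := fun h => by rw [h, SimpleGraph.dist_self] at hd; omega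
      obtain ⟨v1, v2⟩ := pred_adj v hv
      have : Quotient.mk S u = par (Quotient.mk S v) := by
        rw [par_mk]
        refine Quotient.sound ⟨by omega, .cons huv (.cons v1.symm .nil), fun w hw => ?_⟩
        simp only [SimpleGraph.Walk.support_cons, List.mem_cons,
          SimpleGraph.Walk.support_nil, List.not_mem_nil, or_false] at hw
        rcases hw with rfl | rfl | rfl <;> omega
      rw [this]
      exact parentGraph_adj hlvl (by rw [lvl_mk]; omega)
    intro u v huv
    have e1 := hG.dist_triangle (u := o) (v := u) (w := v)
    have e2 := hG.dist_triangle (u := o) (v := v) (w := u)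
    rw [SimpleGraph.dist_eq_one_iff_adj.2 huv] at e1
    rw [SimpleGraph.dist_eq_one_iff_adj.2 huv.symm] at e2
    rcases lt_trichotomy (G.dist o u) (G.dist o v) with hlt | heq | hlt
    · exact (SimpleGraph.dist_eq_one_iff_adj.2 (up u v huv (by omega)).symm).le
    · have : Quotient.mk S u = Quotient.mk S v := by
        refine Quotient.sound ⟨heq, .cons huv .nil, fun w hw => ?_⟩
        simp only [SimpleGraph.Walk.support_cons, List.mem_cons,
          SimpleGraph.Walk.support_nil, List.not_mem_nil, or_false] at hw
        rcases hw with rfl | rfl <;> omega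
      rw [this, SimpleGraph.dist_self]
      omega
    · exact (SimpleGraph.dist_eq_one_iff_adj.2 (up v u huv.symm (by omega))).le
  have hlip : ∀ u v, (parentGraph par lvl).dist (Quotient.mk S u) (Quotient.mk S v) ≤
      G.dist u v := by
    have : ∀ {u v : U} (W : G.Walk u v),
        (parentGraph par lvl).dist (Quotient.mk S u) (Quotient.mk S v) ≤ W.length := by
      intro u v W
      induction W with
      | nil => simp
      | @cons u z v hadj W ih =>
        have e1 := htree.connected.dist_triangle (u := Quotient.mk S u) (v := Quotient.mk S z)
          (w := Quotient.mk S v)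
        have e2 := hstep u z hadj
        rw [SimpleGraph.Walk.length_cons]
        omega
    intro u v
    obtain ⟨W, hW⟩ := hG.exists_walk_length_eq_dist u v
    exact hW ▸ this W
  -- clusters are bounded, so distances do not decrease much
  have hiter : ∀ (j : ℕ) (v : U), ∃ v', par^[j] (Quotient.mk S v) = Quotient.mk S v' ∧
      G.dist v v' ≤ j := by
    intro j
    induction j with
    | zero => exact fun v => ⟨v, rfl, by simp⟩
    | succ j ih =>
      intro v
      obtain ⟨v', h1, h2⟩ := ih (pred v)
      refine ⟨v', by rw [Function.iterate_succ_apply, par_mk, h1], ?_⟩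
      have e1 := hG.dist_triangle (u := v) (v := pred v) (w := v')
      have e2 : G.dist v (pred v) ≤ 1 := by
        by_cases hv : v = o
        · rw [hv, pred_o]
          simp
        · exact (SimpleGraph.dist_eq_one_iff_adj.2 (pred_adj v hv).1.symm).le
      omega
  have hlow : ∀ u v, G.dist u v ≤
      (parentGraph par lvl).dist (Quotient.mk S u) (Quotient.mk S v) + (6 * δ + 1) := by
    intro u v
    obtain ⟨W, hW⟩ := htree.connected.exists_walk_length_eq_dist (Quotient.mk S u)
      (Quotient.mk S v)
    obtain ⟨j, k, hjk, hanc⟩ := exists_common_ancestor W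
    obtain ⟨u', hu', du⟩ := hiter j u
    obtain ⟨v', hv', dv⟩ := hiter k v
    have hcl : SameCluster G o u' v' := Quotient.exact (hu'.symm.trans (hanc.trans hv'))
    have e0 := h.dist_le_of_sameCluster hG hcl
    have e1 := hG.dist_triangle (u := u) (v := u') (w := v)
    have e2 := hG.dist_triangle (u := u') (v := v') (w := v)
    rw [SimpleGraph.dist_comm (u := v')] at e2
    omega
  refine ⟨hG, Quotient S, parentGraph par lvl, htree, Quotient.mk S, fun x y => ⟨?_, ?_⟩, ?_⟩
  · have : (G.dist x y : ℝ) ≤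
        (parentGraph par lvl).dist (Quotient.mk S x) (Quotient.mk S y) + (6 * δ + 1) := by
      exact_mod_cast hlow x y
    rw [inv_one, one_mul]
    linarith
  · have h1 : ((parentGraph par lvl).dist (Quotient.mk S x) (Quotient.mk S y) : ℝ) ≤
        G.dist x y := by
      exact_mod_cast hlip x y
    have h2 : (0 : ℝ) ≤ 6 * δ + 1 := by positivity
    linarith
  · intro t
    obtain ⟨v, rfl⟩ := Quotient.exists_rep t
    refine ⟨v, ?_⟩
    rw [SimpleGraph.dist_self]
    push_cast
    positivity

theorem IsQuasiTreeWith.of_iso {U' : Type u} {G' : SimpleGraph U'} {L A : ℝ} (e : G ≃g G')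
    (h : IsQuasiTreeWith L A G') : IsQuasiTreeWith L A G := by
  obtain ⟨hc, T, Γ, hΓ, f, hf, hsurj⟩ := h
  have hle : ∀ {U₁ U₂ : Type u} {G₁ : SimpleGraph U₁} {G₂ : SimpleGraph U₂} (e : G₁ ≃g G₂)
      (_ : G₁.Connected) (x y : U₁), G₂.dist (e x) (e y) ≤ G₁.dist x y := by
    intro U₁ U₂ G₁ G₂ e hc x y
    obtain ⟨W, hW⟩ := hc.exists_walk_length_eq_dist x y
    rw [← hW, ← SimpleGraph.Walk.length_map e.toHom W]
    exact SimpleGraph.dist_le _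
  have hc' : G.Connected := e.connected_iff.2 hc
  have hdist : ∀ x y, G'.dist (e x) (e y) = G.dist x y := by
    intro x y
    refine le_antisymm (hle e hc' x y) ?_
    have := hle e.symm hc (e x) (e y)
    rwa [e.symm_apply_apply, e.symm_apply_apply] at this
  refine ⟨hc', T, Γ, hΓ, f ∘ e, fun x y => ?_, fun t => ?_⟩
  · rw [← hdist]
    exact hf _ _
  · obtain ⟨x, hx⟩ := hsurj t
    exact ⟨e.symm x, by simpa using hx⟩

/-! ### Bottlenecks of factored contact graphs -/

theorem contactGraph_adj_of_mem_carrier {H K : Hyperplane X} (hne : H ≠ K) {v : V}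
    (hH : v ∈ carrier X H) (hK : v ∈ carrier X K) : (contactGraph X).Adj H K := by
  by_cases hc : Crosses X H K
  · exact ⟨hne, Or.inl hc⟩
  · exact ⟨hne, Or.inr ⟨⟨v, hH, hK⟩, hc⟩⟩

theorem carrier_inter_of_contactGraph_adj {H K : Hyperplane X} (h : (contactGraph X).Adj H K) :
    (carrier X H ∩ carrier X K).Nonempty :=
  h.2.elim Crosses.carrier_inter fun h => h.1

/-- A domain contains every hyperplane that separates two of its elements. -/
theorem IsQuasiMedianGraph.mem_domain_of_separates (hX : IsQuasiMedianGraph X)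
    {J : Set (Hyperplane X)} (hJ : J ∈ domains X) {H K L : Hyperplane X} (hK : K ∈ J) (hL : L ∈ J)
    (h : Separates X H K L) : H ∈ J := by
  obtain ⟨-, rfl | ⟨s, -, rfl⟩⟩ := hJ
  · trivial
  · simp only [Set.mem_iInter] at hK hL ⊢
    exact fun G hG => hX.crosses_of_separates h (hK G hG).2 (hL G hG).2

/-- Carriers are one-sided, so a single pair of vertices on different sides would make `H` separate
two elements of `F`, hence belong to `F`. -/
theorem IsQuasiMedianGraph.sameSide_of_mem_domain (hX : IsQuasiMedianGraph X)
    {F : Set (Hyperplane X)} (hF : F ∈ domains X) {H K L : Hyperplane X} (hH : H ∉ F)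
    (hK : K ∈ F) (hL : L ∈ F) (hHK : H ≠ K ∧ ¬ Crosses X H K) (hHL : H ≠ L ∧ ¬ Crosses X H L)
    {u v : V} (hu : u ∈ carrier X K) (hv : v ∈ carrier X L) : SameSide X H u v := by
  by_contra hcon
  refine hH (hX.mem_domain_of_separates hF hK hL ⟨hHK, hHL, fun u' hu' v' hv' h => hcon ?_⟩)
  exact ((hX.sameSide_of_mem_carrier hHK.1.symm (fun h => hHK.2 h.symm) hu hu').trans h).trans
    (hX.sameSide_of_mem_carrier hHL.1.symm (fun h => hHL.2 h.symm) hv' hv)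

/-- The hyperplanes represented by a vertex of the factored contact graph. -/
def hyperplanesOf : Hyperplane X ⊕ ProjVertex X → Set (Hyperplane X) :=
  Sum.elim (fun H => {H}) (fun F => F.1)

/-- The hyperplanes represented by `z` that neither equal nor cross `H` lie on the side of `u`. -/
def OnSideOf (X : SimpleGraph V) (H : Hyperplane X) (u : V) (z : Hyperplane X ⊕ ProjVertex X) :
    Prop :=
  ∀ K ∈ hyperplanesOf z, H ≠ K → ¬ Crosses X H K → ∀ v ∈ carrier X K, SameSide X H u v

theorem OnSideOf.of_adj (hX : IsQuasiMedianGraph X) {H : Hyperplane X} {u : V}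
    {y z : Hyperplane X ⊕ ProjVertex X} (hadj : (factoredContactGraph X).Adj y z)
    (hy : ¬ (y = Sum.inl H ∨ (factoredContactGraph X).Adj y (Sum.inl H)))
    (hz : ¬ (z = Sum.inl H ∨ (factoredContactGraph X).Adj z (Sum.inl H)))
    (h : OnSideOf X H u y) : OnSideOf X H u z := by
  have far : ∀ K : Hyperplane X,
      ¬ (Sum.inl K = (Sum.inl H : Hyperplane X ⊕ ProjVertex X) ∨
        (factoredContactGraph X).Adj (Sum.inl K) (Sum.inl H)) → H ≠ K ∧ ¬ Crosses X H K := by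
    intro K hK
    have hne : H ≠ K := fun h => hK (Or.inl (h ▸ rfl))
    exact ⟨hne, fun hc => hK (Or.inr ⟨hne.symm, Or.inl hc.symm⟩)⟩
  -- Contact passes the side on through a common carrier vertex, entering a projection vertex
  -- through `sameSide_of_mem_domain`, and leaving one by restriction to an element of its domain.
  rcases y with K | F <;> rcases z with L | F'
  · obtain ⟨h1, h2⟩ := far K hy
    rintro M rfl hne hc v hv
    obtain ⟨w, hw, hw'⟩ := carrier_inter_of_contactGraph_adj hadj
    exact (h K rfl h1 h2 w hw).trans
      (hX.sameSide_of_mem_carrier hne.symm (fun h => hc h.symm) hw' hv)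
  · obtain ⟨h1, h2⟩ := far K hy
    intro M hM hne hc v hv
    obtain ⟨w, hw⟩ := carrier_nonempty K
    exact (h K rfl h1 h2 w hw).trans (hX.sameSide_of_mem_domain F'.2.1
      (fun hH => hz (Or.inr hH)) hadj hM ⟨h1, h2⟩ ⟨hne, hc⟩ hw hv)
  · intro M hM hne hc v hv
    obtain rfl : M = L := hM
    exact h M hadj hne hc v hv
  · exact hadj.elim

variable {J : Set (Hyperplane X)}

theorem OnSideOf.of_walk (hX : IsQuasiMedianGraph X) {H : Hyperplane X} {u : V}
    {y z : domainVertices X J} (W : (factoredContactGraphOf X J).Walk y z)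
    (hW : ∀ w ∈ W.support, ¬ (w.1 = Sum.inl H ∨ (factoredContactGraph X).Adj w.1 (Sum.inl H)))
    (h : OnSideOf X H u y.1) : OnSideOf X H u z.1 := by
  induction W with
  | nil => exact h
  | cons hadj W ih =>
    exact ih (fun w hw => hW w (by simp [hw]))
      (OnSideOf.of_adj hX hadj (hW _ (by simp)) (hW _ (by simp)) h)

/-- A hyperplane of `J` as a vertex of the factored contact graph of `J`. -/
def hyperplaneVertex (K : Hyperplane X) (hK : K ∈ J) : domainVertices X J := ⟨Sum.inl K, hK⟩

/-- Every walk between two hyperplanes passes near each hyperplane that separates them. -/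
theorem exists_mem_support_of_separates (hX : IsQuasiMedianGraph X) {H K L : Hyperplane X}
    (hH : H ∈ J) (hK : K ∈ J) (hL : L ∈ J) (h : Separates X H K L)
    (W : (factoredContactGraphOf X J).Walk (hyperplaneVertex K hK) (hyperplaneVertex L hL)) :
    ∃ w ∈ W.support, (factoredContactGraphOf X J).dist (hyperplaneVertex H hH) w ≤ 1 := by
  by_contra hcon
  obtain ⟨⟨h1, h1'⟩, ⟨h2, h2'⟩, h3⟩ := h
  obtain ⟨u, hu⟩ := carrier_nonempty K
  obtain ⟨v, hv⟩ := carrier_nonempty L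
  have hside : OnSideOf X H u (hyperplaneVertex L hL).1 := by
    refine OnSideOf.of_walk hX W (fun w hw hw' => hcon ⟨w, hw, ?_⟩) ?_
    · rcases hw' with hw' | hw'
      · rw [show w = hyperplaneVertex H hH from Subtype.ext hw', SimpleGraph.dist_self]
        omega
      · have : (factoredContactGraphOf X J).Adj (hyperplaneVertex H hH) w := hw'.symm
        exact (SimpleGraph.dist_eq_one_iff_adj.2 this).le
    · intro M hM _ _ v hv
      obtain rfl : M = K := hM
      exact hX.sameSide_of_mem_carrier h1.symm (fun h => h1' h.symm) hu hv
  exact h3 u hu v hv (hside L rfl h2 h2' v hv)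

/-- Two hyperplanes of a domain are joined by a walk through hyperplanes that separate them. -/
theorem exists_walk_separates (hX : IsQuasiMedianGraph X) (hJ : J ∈ domains X)
    {K L : Hyperplane X} (hK : K ∈ J) (hL : L ∈ J) :
    ∃ P : (factoredContactGraphOf X J).Walk (hyperplaneVertex K hK) (hyperplaneVertex L hL),
      ∀ z ∈ P.support, z = hyperplaneVertex K hK ∨ z = hyperplaneVertex L hL ∨
        ∃ (H : Hyperplane X) (hH : H ∈ J), z = hyperplaneVertex H hH ∧
          Separates X H K L := by
  obtain ⟨⟨p, q⟩, hpq, hmin⟩ := (measure fun x : V × V => X.dist x.1 x.2).wf.has_min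
    {x | x.1 ∈ carrier X K ∧ x.2 ∈ carrier X L}
    ((carrier_nonempty K).elim fun p hp => (carrier_nonempty L).elim fun q hq => ⟨(p, q), hp, hq⟩)
  obtain ⟨hp, hq⟩ : p ∈ carrier X K ∧ q ∈ carrier X L := hpq
  have hmin' : ∀ p' ∈ carrier X K, ∀ q' ∈ carrier X L, X.dist p q ≤ X.dist p' q' :=
    fun p' hp' q' hq' => not_lt.1 (hmin (p', q') ⟨hp', hq'⟩)
  -- Induction along a geodesic from `p` to `q`: `v` is the current vertex and `M` the hyperplane
  -- crossed last, or `K` at the start.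
  have key : ∀ (n : ℕ) (v : V) (M : Hyperplane X) (hM : M ∈ J), X.dist v q = n →
      X.dist p v + X.dist v q = X.dist p q → v ∈ carrier X M →
      (M = K ∨ Separates X M K L) →
      ∃ P : (factoredContactGraphOf X J).Walk (hyperplaneVertex M hM) (hyperplaneVertex L hL),
      ∀ z ∈ P.support, z = hyperplaneVertex K hK ∨ z = hyperplaneVertex L hL ∨
        ∃ (H : Hyperplane X) (hH : H ∈ J), z = hyperplaneVertex H hH ∧
          Separates X H K L := by
    have start : ∀ (M : Hyperplane X) (hM : M ∈ J),
        (M = K ∨ Separates X M K L) →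
        hyperplaneVertex M hM = hyperplaneVertex K hK ∨
        hyperplaneVertex M hM = hyperplaneVertex L hL ∨
        ∃ (H : Hyperplane X) (hH : H ∈ J), hyperplaneVertex M hM = hyperplaneVertex H hH ∧
          Separates X H K L := by
      rintro M hM (rfl | h)
      · exact Or.inl rfl
      · exact Or.inr (Or.inr ⟨M, hM, rfl, h⟩)
    intro n
    induction n with
    | zero =>
      intro v M hM hn hgeo hv hMs
      rw [hX.connected.dist_eq_zero_iff] at hn
      subst hn
      by_cases hML : M = L
      · subst hML
        exact ⟨.nil, fun z hz => Or.inr (Or.inl (by simpa using hz))⟩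
      · have hadj : (factoredContactGraphOf X J).Adj (hyperplaneVertex M hM)
            (hyperplaneVertex L hL) := contactGraph_adj_of_mem_carrier hML hv hq
        refine ⟨.cons hadj .nil, fun z hz => ?_⟩
        simp only [SimpleGraph.Walk.support_cons, SimpleGraph.Walk.support_nil, List.mem_cons,
          List.not_mem_nil, or_false] at hz
        rcases hz with rfl | rfl
        · exact start M hM hMs
        · exact Or.inr (Or.inl rfl)
    | succ n ih =>
      intro v M hM hn hgeo hv hMs
      obtain ⟨W, hW⟩ := hX.connected.exists_walk_length_eq_dist v q
      rw [hn] at hW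
      obtain ⟨w, hvw, hwq⟩ : ∃ w, X.Adj v w ∧ X.dist w q = n := by
        match W, hW with
        | .cons (v := w) hadj W', hW =>
          refine ⟨w, hadj, ?_⟩
          have e1 := SimpleGraph.dist_le W'
          have e2 := hX.connected.dist_triangle (u := v) (v := w) (w := q)
          rw [SimpleGraph.dist_eq_one_iff_adj.2 hadj] at e2
          simp only [SimpleGraph.Walk.length_cons] at hW
          omega
      set H : Hyperplane X := dualHyperplane X ⟨s(v, w), hvw⟩ with hH
      have hHd : IsDual X H v w := ⟨hvw, rfl⟩
      have hsep := hX.separates_of_dist hp hq hmin' hHd (by omega)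
      have hHJ := hX.mem_domain_of_separates hJ hK hL hsep
      have e1 := hX.dist_le_succ_of_adj p hvw.symm
      have e2 := hX.connected.dist_triangle (u := p) (v := w) (w := q)
      obtain ⟨P, hP⟩ := ih w H hHJ hwq (by omega) (mem_carrier_iff.2 ⟨v, hHd.symm⟩) (Or.inr hsep)
      by_cases hMH : M = H
      · subst hMH
        exact ⟨P, hP⟩
      · have hadj : (factoredContactGraphOf X J).Adj (hyperplaneVertex M hM)
            (hyperplaneVertex H hHJ) :=
          contactGraph_adj_of_mem_carrier hMH hv (mem_carrier_iff.2 ⟨w, hHd⟩)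
        refine ⟨.cons hadj P, fun z hz => ?_⟩
        rw [SimpleGraph.Walk.support_cons, List.mem_cons] at hz
        rcases hz with rfl | hz
        · exact start M hM hMs
        · exact hP z hz
  exact key _ p K hK rfl (by simp) hp (Or.inl rfl)

theorem exists_walk_hyperplaneVertex (x : domainVertices X J) :
    ∃ (K : Hyperplane X) (hK : K ∈ J)
      (P : (factoredContactGraphOf X J).Walk x (hyperplaneVertex K hK)), P.length ≤ 1 ∧
      ∀ z ∈ P.support, z = x ∨ z = hyperplaneVertex K hK := by
  obtain ⟨K | F, hx⟩ := x
  · exact ⟨K, hx, .nil, Nat.zero_le 1, fun z hz => Or.inl (List.mem_singleton.1 hz)⟩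
  · obtain ⟨K, hK⟩ := F.2.1.1
    have hadj : (factoredContactGraphOf X J).Adj ⟨Sum.inr F, hx⟩ (hyperplaneVertex K (hx.1 hK)) :=
      hK
    exact ⟨K, hx.1 hK, .cons hadj .nil, by simp, fun z hz => by simpa using hz⟩

/-- Separating hyperplanes are within one of any walk from `K` to `L`. Extending `W` by `P` and `Q`
yields such a walk, and the added ends `K` and `L` are within one of `x` and `y`: together two. -/
theorem hasBottlenecks_factoredContactGraphOf (hX : IsQuasiMedianGraph X) (hJ : J ∈ domains X) :
    HasBottlenecks (factoredContactGraphOf X J) 2 := by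
  have hne : Nonempty (domainVertices X J) := hJ.1.elim fun K hK => ⟨hyperplaneVertex K hK⟩
  have hconn : (factoredContactGraphOf X J).Connected := by
    refine ⟨fun x y => ?_⟩
    obtain ⟨K, hK, P, -, -⟩ := exists_walk_hyperplaneVertex x
    obtain ⟨L, hL, Q, -, -⟩ := exists_walk_hyperplaneVertex y
    obtain ⟨R, -⟩ := exists_walk_separates hX hJ hK hL
    exact ⟨(P.append R).append Q.reverse⟩
  intro x y
  obtain ⟨K, hK, P, hPl, hP⟩ := exists_walk_hyperplaneVertex x
  obtain ⟨L, hL, Q, hQl, hQ⟩ := exists_walk_hyperplaneVertex y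
  obtain ⟨R, hR⟩ := exists_walk_separates hX hJ hK hL
  have hx := (SimpleGraph.dist_le P).trans hPl
  have hy := (SimpleGraph.dist_le Q).trans hQl
  refine ⟨(P.append R).append Q.reverse, fun z hz W => ?_⟩
  have hz' : z = x ∨ z = y ∨ z = hyperplaneVertex K hK ∨ z = hyperplaneVertex L hL ∨
      ∃ (H : Hyperplane X) (hH : H ∈ J), z = hyperplaneVertex H hH ∧
        Separates X H K L := by
    rw [SimpleGraph.Walk.mem_support_append_iff, SimpleGraph.Walk.mem_support_append_iff,
      SimpleGraph.Walk.support_reverse, List.mem_reverse] at hz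
    rcases hz with (hz | hz) | hz
    · exact (hP z hz).imp id fun h => Or.inr (Or.inl h)
    · exact Or.inr (Or.inr (hR z hz))
    · rcases hQ z hz with h | h
      · exact Or.inr (Or.inl h)
      · exact Or.inr (Or.inr (Or.inr (Or.inl h)))
  have hxW := W.start_mem_support
  have hyW := W.end_mem_support
  rcases hz' with rfl | rfl | rfl | rfl | ⟨H, hH, rfl, hsep⟩
  · exact ⟨z, hxW, by simp⟩
  · exact ⟨z, hyW, by simp⟩
  · exact ⟨x, hxW, by rw [SimpleGraph.dist_comm]; omega⟩
  · exact ⟨y, hyW, by rw [SimpleGraph.dist_comm]; omega⟩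
  · obtain ⟨w, hw, hd⟩ :=
      exists_mem_support_of_separates hX hH hK hL hsep ((P.reverse.append W).append Q)
    rw [SimpleGraph.Walk.mem_support_append_iff, SimpleGraph.Walk.mem_support_append_iff,
      SimpleGraph.Walk.support_reverse, List.mem_reverse] at hw
    rcases hw with (hw | hw) | hw
    · rcases hP w hw with rfl | rfl
      · exact ⟨w, hxW, by omega⟩
      · refine ⟨x, hxW, (hconn.dist_triangle (v := hyperplaneVertex K hK)).trans ?_⟩
        rw [SimpleGraph.dist_comm (v := x)]
        omega
    · exact ⟨w, hw, by omega⟩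
    · rcases hQ w hw with rfl | rfl
      · exact ⟨w, hyW, by omega⟩
      · refine ⟨y, hyW, (hconn.dist_triangle (v := hyperplaneVertex L hL)).trans ?_⟩
        rw [SimpleGraph.dist_comm (v := y)]
        omega

/-- The constant is `6 * δ + 1` with `δ = 2`. -/
theorem isQuasiTreeWith_factoredContactGraphOf (hX : IsQuasiMedianGraph X) (hJ : J ∈ domains X) :
    IsQuasiTreeWith 1 13 (factoredContactGraphOf X J) := by
  have : Nonempty (domainVertices X J) := hJ.1.elim fun K hK => ⟨hyperplaneVertex K hK⟩
  have h := (hasBottlenecks_factoredContactGraphOf hX hJ).isQuasiTreeWith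
  norm_num at h
  exact h

/-- The factored contact graph of `X` is that of its largest domain. -/
def factoredContactGraphIso (X : SimpleGraph V) :
    factoredContactGraph X ≃g factoredContactGraphOf X Set.univ where
  toFun z := ⟨z, by
    rcases z with H | F
    · exact Set.mem_univ H
    · exact (Set.ssubset_univ_iff).2 F.2.2⟩
  invFun z := z.1
  left_inv _ := rfl
  right_inv _ := rfl
  map_rel_iff' := Iff.rfl

end QMGraph

/-- The factored contact graphs are uniform quasi-trees: there are absolute constants `L ≥ 1` and
`A ≥ 0` such that for every quasi-median graph `X` whose crossing graph admits a graph factor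
system, the factored contact graph of `X` and the factored contact graph of each of its domains are
`(L, A)`-quasi-isometric to trees. -/
theorem lemma4p15 :
    ∃ L A : ℝ, 1 ≤ L ∧ 0 ≤ A ∧
      ∀ (V : Type u) (X : SimpleGraph V), QMGraph.IsQuasiMedianGraph X →
        (∃ 𝔉 : Set (Set (QMGraph.Hyperplane X)),
          QMGraph.IsGraphFactorSystem (QMGraph.crossingGraph X) 𝔉) →
        QMGraph.IsQuasiTreeWith L A (QMGraph.factoredContactGraph X) ∧
        ∀ J ∈ QMGraph.domains X,
          QMGraph.IsQuasiTreeWith L A (QMGraph.factoredContactGraphOf X J) := by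
  refine ⟨1, 13, le_rfl, by norm_num, fun V X hX ⟨𝔉, h𝔉⟩ => ⟨?_, fun J hJ =>
    QMGraph.isQuasiTreeWith_factoredContactGraphOf hX hJ⟩⟩
  -- The whole crossing graph is a member of the factor system and so is nonempty, which makes
  -- `Set.univ` a domain.
  exact .of_iso (QMGraph.factoredContactGraphIso X)
    (QMGraph.isQuasiTreeWith_factoredContactGraphOf hX
      ⟨h𝔉.nonempty_of_mem _ h𝔉.univ_mem, Or.inl rfl⟩)
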